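/- **Setting.** Let $\mathcal A\subset\mathbb R$ be a non-trivial interval (possibly unbounded) such that the sets $$S(\rho,\mathcal A)=\{|\zeta|<\rho\}\cup\{re^{i\theta}\mid r>0,\ \theta\in\mathcal A\}\subset\mathbb C,\qquad \rho>0,$$ are open (which is the case whenever $\mathcal A$ is open). For $\tilde\phi=c+\sum_{n\ge0}a_nz^{-n-1}\in\mathbb C[[z^{-1}]]$ let $\hat\varphi(\zeta)=\sum_{n\ge0}a_n\zeta^n/n!$. If $\hat\varphi$ converges near $0$ and extends holomorphically to $S(\rho,\mathcal A)$, put, for $\tau\in\mathbb R$, $$\|\tilde\phi\|_{\rho,\tau}=|c|+\sup_{\zeta\in S(\rho,\mathcal A)}e^{-\tau|\zeta|}\,|\hat\varphi(\zeta)|\in[0,\infty],$$ and put $\|\tilde\phi\|_{\rho,\tau}=\infty$ otherwise. The series $\tilde\phi$ is *1-summable in the directions of $\mathcal A$* if $\|\tilde\phi\|_{\rho,\tau}<\infty$ for some $\rho>0$ and $\tau\in\mathbb R$. Its *Borel sum* is then the function defined on $$\Sigma^{\mathcal A}_\tau=\bigcup_{\theta\in\mathcal A}\{z\mid \operatorname{Re}(ze^{i\theta})>\tau\}$$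 (a subset of $\mathbb C$, but viewed on the Riemann surface of the logarithm, the half-plane of index $\theta$ being the one with $|\arg z+\theta|<\pi/2$, if $\tau\ge0$ and $\mathcal A$ has length at least $\pi$) by $$(\operatorname{Sum}^{\mathcal A}\tilde\phi)(z)=c+\int_0^{e^{i\theta}\infty}\hat\varphi(\zeta)e^{-z\zeta}\,d\zeta$$ with any $\theta\in\mathcal A$ such that $z$ lies in the half-plane of index $\theta$. **Theorem.** Let $\tilde F(z,y)=\sum_{k\ge0}\tilde F_k(z)y^k\in\mathbb C[[z^{-1},y]]$ and suppose that $\|\tilde F_k\|_{\rho,\tau}\le AB^k$ for all $k\in\mathbb N$, with some $\rho,A,B>0$ and $\tau\in\mathbb R$ independent of $k$. Suppose moreover that $\tilde F_0$ has no constant term and that the constant term of $\tilde F_1$ is nonzero. Then: 1. The integrals defining $\operatorname{Sum}^{\mathcal A}\tilde F_k$ on $\Sigma^{\mathcal A}_\tau$ converge and do not depend on the admissible direction $\theta$; the series $$\mathcal F^{\mathcal A}(z,y)=\sum_{k\ge0}(\operatorname{Sum}^{\mathcal A}\tilde F_k)(z)\,y^k$$ converges for $z\in\Sigma^{\mathcal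 A}_\tau$, $|y|<1/B$, and is holomorphic in $\Sigma^{\mathcal A}_\tau\times\{|y|<1/B\}$. The same holds with $\tau$ replaced by any $\sigma\ge\tau$. 2. There is a unique formal series $\tilde\varphi(z)\in z^{-1}\mathbb C[[z^{-1}]]$ such that $\tilde F(z,\tilde\varphi(z))=0$. 3. This $\tilde\varphi$ is 1-summable in the directions of $\mathcal A$, and there is $\tau_0\ge\tau$ such that for every $\tau'\ge\tau_0$ the Borel sum of $\tilde\varphi$ is well defined (convergent, and independent of the admissible direction) and holomorphic on $\Sigma^{\mathcal A}_{\tau'}$, and for all $z\in\Sigma^{\mathcal A}_{\tau'}$ $$|(\operatorname{Sum}^{\mathcal A}\tilde\varphi)(z)|<1/B,\qquad \mathcal F^{\mathcal A}\bigl(z,(\operatorname{Sum}^{\mathcal A}\tilde\varphi)(z)\bigr)=0.$$ -/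

import Mathlib

open Set MeasureTheory
open scoped PowerSeries ENNReal

noncomputable section

/-! Formal series in `z⁻¹` are modelled by `ℂ⟦X⟧`, the indeterminate `X` standing for `z⁻¹`. A series
in `ℂ[[z⁻¹, y]] = ℂ[[z⁻¹]][[y]]` is an element of `ℂ⟦X⟧⟦X⟧`, the outer indeterminate being `y`. -/

namespace BorelLaplace

/-- The formal Borel transform `∑ aₙ z^(-n-1) ↦ ∑ aₙ ζⁿ / n!`; the constant term is ignored. -/
def borelTransform (φ : ℂ⟦X⟧) : ℂ⟦X⟧ :=
  PowerSeries.mk fun n => PowerSeries.coeff (n + 1) φ / (n.factorial : ℂ)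

/-- `S(ρ, 𝒜)`: the open disc of radius `ρ` together with the open rays of directions in `𝒜`. -/
def sector (𝒜 : Set ℝ) (ρ : ℝ) : Set ℂ :=
  Metric.ball 0 ρ ∪
    {ζ : ℂ | ∃ r : ℝ, 0 < r ∧ ∃ θ ∈ 𝒜, ζ = (r : ℂ) * Complex.exp (Complex.I * (θ : ℂ))}

/-- `g` is holomorphic on `S(ρ, 𝒜)` and its Taylor series at the origin is the Borel transform
of `φ`. -/
def IsBorelExtension (𝒜 : Set ℝ) (ρ : ℝ) (φ : ℂ⟦X⟧) (g : ℂ → ℂ) : Prop :=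
  DifferentiableOn ℂ g (sector 𝒜 ρ) ∧
    ∀ ζ ∈ Metric.ball (0 : ℂ) ρ, HasSum (fun n => PowerSeries.coeff n (borelTransform φ) * ζ ^ n) (g ζ)

/-- The norm `|c| + sup_{S(ρ, 𝒜)} e^{-τ|ζ|} |φ̂(ζ)|` of `φ = c + 𝓑⁻¹ φ̂`. The extension `g` of `φ̂` to
`S(ρ, 𝒜)` is unique there when it exists, so that the infimum is over one value; the norm is `⊤` if
there is no extension. -/
def expNorm (𝒜 : Set ℝ) (ρ τ : ℝ) (φ : ℂ⟦X⟧) : ℝ≥0∞ :=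
  ⨅ (g : ℂ → ℂ) (_ : IsBorelExtension 𝒜 ρ φ g),
    ENNReal.ofReal ‖PowerSeries.constantCoeff φ‖ +
      ⨆ ζ ∈ sector 𝒜 ρ, ENNReal.ofReal (Real.exp (-τ * ‖ζ‖) * ‖g ζ‖)

/-- `φ` is `1`-summable in the directions of `𝒜`. -/
def OneSummable (𝒜 : Set ℝ) (φ : ℂ⟦X⟧) : Prop :=
  ∃ ρ : ℝ, 0 < ρ ∧ ∃ g : ℂ → ℂ, IsBorelExtension 𝒜 ρ φ g ∧
    ∃ τ C : ℝ, 0 < C ∧ ∀ ζ ∈ sector 𝒜 ρ, ‖g ζ‖ ≤ C * Real.exp (τ * ‖ζ‖)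

/-- The analytic continuation of the Borel transform of `φ` to some `S(ρ, 𝒜)`, `ρ > 0`
(its values on the rays of directions in `𝒜` do not depend on `ρ`). -/
def borelFun (𝒜 : Set ℝ) (φ : ℂ⟦X⟧) : ℂ → ℂ :=
  Classical.epsilon fun g => ∃ ρ : ℝ, 0 < ρ ∧ IsBorelExtension 𝒜 ρ φ g

/-- The function `t ↦ g(t e^{iθ}) e^{-z t e^{iθ}} e^{iθ}`, whose integral over `t > 0` is the Laplace
transform of `g` in the direction `θ`. -/
def laplaceIntegrand (g : ℂ → ℂ) (θ : ℝ) (z : ℂ) (t : ℝ) : ℂ :=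
  g ((t : ℂ) * Complex.exp (Complex.I * (θ : ℂ))) *
    Complex.exp (-(z * ((t : ℂ) * Complex.exp (Complex.I * (θ : ℂ))))) *
      Complex.exp (Complex.I * (θ : ℂ))

/-- The Laplace transform of `g` along the ray of direction `θ`. -/
def laplace (g : ℂ → ℂ) (θ : ℝ) (z : ℂ) : ℂ :=
  ∫ t in Ioi (0 : ℝ), laplaceIntegrand g θ z t

/-- The case in which the union of half-planes `Re (z e^{iθ}) > τ` (`θ ∈ 𝒜`) is viewed on the Riemann
surface of the logarithm: `τ ≥ 0` and the interval `𝒜` has length at least `π`. -/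
def OnLogSurface (𝒜 : Set ℝ) (τ : ℝ) : Prop :=
  0 ≤ τ ∧ ENNReal.ofReal Real.pi ≤ volume 𝒜

open Classical in
/-- Points are given by a complex coordinate `p`, which is `z` itself in the planar case, and `log z`
on the Riemann surface of the logarithm. This is the complex number `z` below `p`. -/
def proj (𝒜 : Set ℝ) (τ : ℝ) (p : ℂ) : ℂ :=
  if OnLogSurface 𝒜 τ then Complex.exp p else p

/-- The directions `θ ∈ 𝒜` such that `p` lies in the half-plane `Re (z e^{iθ}) > τ`; on the Riemann
surface of the logarithm, this half-plane is the one with `|arg z + θ| < π / 2`. -/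
def directions (𝒜 : Set ℝ) (τ : ℝ) (p : ℂ) : Set ℝ :=
  {θ | θ ∈ 𝒜 ∧ τ < (proj 𝒜 τ p * Complex.exp (Complex.I * (θ : ℂ))).re ∧
    (OnLogSurface 𝒜 τ → |p.im + θ| < Real.pi / 2)}

/-- `Σ^𝒜_τ`: the union of the half-planes `Re (z e^{iθ}) > τ`, `θ ∈ 𝒜`. -/
def sumDomain (𝒜 : Set ℝ) (τ : ℝ) : Set ℂ :=
  {p | (directions 𝒜 τ p).Nonempty}

/-- The Borel sum of `φ` at a point of `Σ^𝒜_τ`: the constant term plus the Laplace transform in any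
admissible direction. -/
def borelSum (𝒜 : Set ℝ) (τ : ℝ) (φ : ℂ⟦X⟧) (p : ℂ) : ℂ :=
  PowerSeries.constantCoeff φ +
    laplace (borelFun 𝒜 φ) (Classical.epsilon fun θ => θ ∈ directions 𝒜 τ p) (proj 𝒜 τ p)

/-- The integrals defining the Borel sum of `φ` on `Σ^𝒜_τ` converge, and all admissible directions
give the same value. -/
def BorelSumWellDefined (𝒜 : Set ℝ) (τ : ℝ) (φ : ℂ⟦X⟧) : Prop :=
  ∀ p : ℂ, ∀ θ ∈ directions 𝒜 τ p,
    IntegrableOn (laplaceIntegrand (borelFun 𝒜 φ) θ (proj 𝒜 τ p)) (Ioi 0) ∧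
      borelSum 𝒜 τ φ p =
        PowerSeries.constantCoeff φ + laplace (borelFun 𝒜 φ) θ (proj 𝒜 τ p)

/-- The formal series `∑ₖ Fₖ φ^k`, summed coefficientwise (for `φ` without constant term, only finitely
many `k` contribute to each coefficient). -/
def formalSubst (F : ℂ⟦X⟧⟦X⟧) (φ : ℂ⟦X⟧) : ℂ⟦X⟧ :=
  PowerSeries.mk fun n => ∑ᶠ k : ℕ, PowerSeries.coeff n (PowerSeries.coeff k F * φ ^ k)

/-- `φ` is a formal solution of `F(z, φ(z)) = 0` in `z⁻¹ ℂ[[z⁻¹]]`. -/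
def IsFormalSolution (F : ℂ⟦X⟧⟦X⟧) (φ : ℂ⟦X⟧) : Prop :=
  PowerSeries.constantCoeff φ = 0 ∧ formalSubst F φ = 0

/-- `ℱ^𝒜(z, y) = ∑ₖ (Sum^𝒜 Fₖ)(z) y^k`. -/
def sumSeries (𝒜 : Set ℝ) (τ : ℝ) (F : ℂ⟦X⟧⟦X⟧) (p y : ℂ) : ℂ :=
  ∑' k : ℕ, borelSum 𝒜 τ (PowerSeries.coeff k F) p * y ^ k

end BorelLaplace

end

/-!
A series `φ = c + ∑ aₙ z⁻ⁿ⁻¹` is `1`-summable with controlled type when its Borel transform extends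
to the sector `S(ρ, 𝒜)` and is at most a multiple of a weight there. For the weight
`W(r) = (M / 8) e^(νr) / (1 + M² r²)`, which satisfies `W * W ≤ W` for the convolution on the
half-line, these series form a Banach algebra `WeightedSector.Alg` for the usual product of formal
series, because the Borel transform turns products into convolutions (`IsBorelExtension.mul`,
`norm_conv_le`). Completeness holds since weighted uniform limits of holomorphic functions are
holomorphic. When `M` and `ν` are large, the weight exceeds `N e^(τr)` with `N` as large as desired
(`mul_exp_le_weight`), so in this algebra the norms of `F₀` and of `F₁ - c₁`, where `c₁ ≠ 0` is the
constant term of `F₁`, are as small as desired, while `‖Fₖ‖ ≤ 2 A Bᵏ`. The equation `∑ Fₖ φᵏ = 0`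
then has a small solution without constant term, the fixed point of the contraction
`φ ↦ φ - c₁⁻¹ ∑ Fₖ φᵏ` (`exists_root`). The coefficients of the series are continuous on the
algebra (`exists_norm_coeff_le`), so this is a formal solution; it is the only one
(`IsFormalSolution.unique`). The Borel sum at a given point is a continuous character of the
algebra (`exists_lap_eq`), of norm at most `1`; applied to the equation, it shows that the Borel sum
of `φ` solves `ℱ(z, y) = 0`.

There remains the independence of the direction (`laplace_eq_of_mem_directions`). The set of the
admissible directions at `z` need not be an interval when the parameter `τ` is negative, but two
admissible directions make an angle less than `π`; hence, by the Phragmén–Lindelöf principle, the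
function `φ̂(ζ) e^(-zζ)`, which decays exponentially on both rays, decays exponentially in the
sector between them (`norm_le_of_decay_boundary`), and the contour can be rotated
(`integral_strip_eq`). The only exception is the case of a negative parameter and an interval `𝒜` of
length at least `π`, in which the same principle shows that `φ̂ = 0` (`eqOn_zero_of_decay`).
-/

noncomputable section

namespace BorelLaplace

open Filter Topology

/-! ### Holomorphic parameter integrals -/

/-- An integral depending on a parameter is holomorphic when the integrand is, and is dominated by
an integrable function: by Cauchy's estimate, so is its derivative. -/
theorem differentiableOn_integral {α : Type*} [MeasurableSpace α] {μ : Measure α} {U : Set ℂ}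
    (hU : IsOpen U) {f : ℂ → α → ℂ} {b : α → ℝ}
    (hmeas : ∀ z ∈ U, AEStronglyMeasurable (f z) μ)
    (hdiff : ∀ᵐ t ∂μ, DifferentiableOn ℂ (fun z => f z t) U)
    (hbound : ∀ᵐ t ∂μ, ∀ z ∈ U, ‖f z t‖ ≤ b t) (hb : Integrable b μ) :
    DifferentiableOn ℂ (fun z => ∫ t, f z t ∂μ) U := by
  intro z₀ hz₀
  obtain ⟨ε, hε, hball⟩ := Metric.isOpen_iff.1 hU z₀ hz₀
  have hr : 0 < ε / 2 := by positivity
  set r := ε / 2 with hrdef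
  have hmem : ∀ z ∈ Metric.ball z₀ (r / 2), Metric.closedBall z (r / 2) ⊆ U := by
    intro z hz w hw
    apply hball
    rw [Metric.mem_ball, Metric.mem_closedBall] at *
    linarith [dist_triangle w z z₀]
  have key := hasDerivAt_integral_of_dominated_loc_of_deriv_le (μ := μ) (F := f) (x₀ := z₀)
    (s := Metric.ball z₀ (r / 2)) (bound := fun t => b t / (r / 2))
    (F' := fun z t => deriv (fun z => f z t) z) (Metric.ball_mem_nhds _ (half_pos hr))
    (Filter.eventually_of_mem (hU.mem_nhds hz₀) hmeas)
    (hb.mono' (hmeas z₀ hz₀) (hbound.mono fun t ht => ht z₀ hz₀)) ?_ ?_ (hb.div_const _) ?_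
  · exact key.2.differentiableAt.differentiableWithinAt
  · -- the derivative is a limit of difference quotients, hence measurable
    let h : ℕ → ℂ := fun n => ((r / (n + 1) : ℝ) : ℂ)
    have hh0 : ∀ n : ℕ, 0 < r / ((n : ℝ) + 1) := fun n => div_pos hr (by positivity)
    have hh : Tendsto h atTop (𝓝[≠] 0) := by
      rw [tendsto_nhdsWithin_iff]
      refine ⟨?_, Eventually.of_forall fun n => ?_⟩
      · have := (tendsto_const_div_atTop_nhds_zero_nat r).comp (tendsto_add_atTop_nat 1)
        have h2 := (Complex.continuous_ofReal.tendsto 0).comp this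
        simpa [h, Function.comp_def] using h2
      · simp only [h, mem_compl_iff, mem_singleton_iff, Complex.ofReal_eq_zero]
        exact (hh0 n).ne'
    have hU' : ∀ n, z₀ + h n ∈ U := by
      intro n
      apply hball
      have : r / ((n : ℝ) + 1) ≤ r := div_le_self hr.le (by linarith [n.cast_nonneg (α := ℝ)])
      simp only [h, Metric.mem_ball, dist_self_add_left, Complex.norm_real, Real.norm_eq_abs,
        abs_of_pos (hh0 n)]
      linarith
    refine aestronglyMeasurable_of_tendsto_ae atTop
      (f := fun n t => (h n)⁻¹ • (f (z₀ + h n) t - f z₀ t))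
      (fun n => ((hmeas _ (hU' n)).sub (hmeas _ hz₀)).const_smul (h n)⁻¹) ?_
    filter_upwards [hdiff] with t ht
    exact ((ht.differentiableAt (hU.mem_nhds hz₀)).hasDerivAt.tendsto_slope_zero).comp hh
  · filter_upwards [hdiff, hbound] with t ht hbt z hz
    refine Complex.norm_deriv_le_of_forall_mem_sphere_norm_le (by positivity) ?_
      (fun w hw => hbt w (hmem z hz (Metric.sphere_subset_closedBall hw)))
    exact (ht.mono (hmem z hz)).diffContOnCl_ball subset_rfl
  · filter_upwards [hdiff] with t ht z hz
    exact (ht.differentiableAt (hU.mem_nhds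
      (hmem z hz (Metric.mem_closedBall_self (by positivity))))).hasDerivAt

/-! ### A Phragmén–Lindelöf estimate and rotation of contours, in logarithmic coordinates -/

/-- Let `H` be holomorphic on a closed horizontal strip of width less than `π`, and of exponential
type in the variable `e^w`. If `H` decays like `exp (-δ |e^w|)` on the two boundary lines, then it
is bounded by `exp (-l Re (e^(w - iψ)))` in the strip, `ψ` being the ordinate of the middle line,
for the value of `l` which gives back the assumption on the boundary. -/
theorem norm_le_of_decay_boundary {a b K C δ : ℝ} (hab : a < b) (hπ : b - a < Real.pi)
    (hδ : 0 ≤ δ) {H : ℂ → ℂ} (hd : ∀ w : ℂ, w.im ∈ Icc a b → DifferentiableAt ℂ H w)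
    (hK : ∀ w : ℂ, w.im ∈ Icc a b → ‖H w‖ ≤ C * Real.exp (K * Real.exp w.re))
    (ha : ∀ w : ℂ, w.im = a → ‖H w‖ ≤ C * Real.exp (-δ * Real.exp w.re))
    (hb : ∀ w : ℂ, w.im = b → ‖H w‖ ≤ C * Real.exp (-δ * Real.exp w.re))
    {w : ℂ} (hw : w.im ∈ Icc a b) :
    ‖H w‖ ≤ C * Real.exp (-(δ / Real.cos ((b - a) / 2)) *
      (Real.exp w.re * Real.cos (w.im - (a + b) / 2))) := by
  have hcos : 0 < Real.cos ((b - a) / 2) :=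
    Real.cos_pos_of_mem_Ioo ⟨by linarith, by linarith⟩
  set l := δ / Real.cos ((b - a) / 2) with hl
  have hl0 : 0 ≤ l := by positivity
  set ψ := (a + b) / 2 with hψ
  let E : ℂ → ℂ := fun w => Complex.exp (l * Complex.exp (w - ψ * Complex.I))
  have hE : ∀ w, ‖E w‖ = Real.exp (l * (Real.exp w.re * Real.cos (w.im - ψ))) := by
    intro w
    simp [E, Complex.norm_exp, Complex.exp_re, Complex.exp_im]
  have hC : 0 ≤ C := by
    have := (norm_nonneg _).trans (hK w hw)
    exact nonneg_of_mul_nonneg_left this (Real.exp_pos _)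
  have hHE : ∀ w : ℂ, w.im ∈ Icc a b → DifferentiableAt ℂ (fun w => H w * E w) w := by
    intro w hw
    refine (hd w hw).mul ?_
    simp only [E]
    fun_prop
  have hbd : ∀ w : ℂ, Real.cos (w.im - ψ) = Real.cos ((b - a) / 2) →
      ‖H w‖ ≤ C * Real.exp (-δ * Real.exp w.re) → ‖H w * E w‖ ≤ C := by
    intro w hc hh
    rw [norm_mul, hE, hc]
    calc _ ≤ C * Real.exp (-δ * Real.exp w.re) *
          Real.exp (l * (Real.exp w.re * Real.cos ((b - a) / 2))) := by gcongr
      _ = C := by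
        rw [mul_assoc, ← Real.exp_add]
        have : -δ * Real.exp w.re + l * (Real.exp w.re * Real.cos ((b - a) / 2)) = 0 := by
          rw [hl]; field_simp; ring
        rw [this]; simp
  have hle : ‖H w * E w‖ ≤ C := by
    refine PhragmenLindelof.horizontal_strip (f := fun w => H w * E w) (a := a) (b := b)
      ?_ ?_ ?_ ?_ hw.1 hw.2
    · have hsub : closure (Complex.im ⁻¹' Ioo a b) ⊆ Complex.im ⁻¹' Icc a b :=
        closure_minimal (preimage_mono Ioo_subset_Icc_self)
          (isClosed_Icc.preimage Complex.continuous_im)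
      exact ⟨fun w hw => (hHE w (Ioo_subset_Icc_self hw)).differentiableWithinAt,
        fun w hw => (hHE w (hsub hw)).continuousAt.continuousWithinAt⟩
    · refine ⟨1, by rw [lt_div_iff₀] <;> linarith, |K| + l, ?_⟩
      refine Asymptotics.IsBigO.of_bound C ?_
      refine Filter.Eventually.filter_mono inf_le_right ?_
      rw [eventually_principal]
      intro w hw
      have hw' : w.im ∈ Icc a b := Ioo_subset_Icc_self hw
      rw [norm_mul, hE, Real.norm_eq_abs, abs_of_pos (Real.exp_pos _), one_mul]
      have h1 : Real.exp w.re ≤ Real.exp |w.re| := Real.exp_le_exp.2 (le_abs_self _)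
      have h2 : K * Real.exp w.re ≤ |K| * Real.exp |w.re| :=
        mul_le_mul (le_abs_self _) h1 (Real.exp_pos _).le (abs_nonneg _)
      have h3 : Real.exp w.re * Real.cos (w.im - ψ) ≤ Real.exp |w.re| := by
        nlinarith [Real.cos_le_one (w.im - ψ), Real.exp_pos w.re]
      calc _ ≤ C * Real.exp (|K| * Real.exp |w.re|) * Real.exp (l * Real.exp |w.re|) := by
            refine mul_le_mul ((hK w hw').trans ?_) ?_ (Real.exp_pos _).le (by positivity)
            · gcongr
            · gcongr
        _ = _ := by rw [mul_assoc, ← Real.exp_add, add_mul]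
    · intro w hw
      refine hbd w ?_ (ha w hw)
      rw [hw, hψ, ← Real.cos_neg]; congr 1; ring
    · intro w hw
      refine hbd w ?_ (hb w hw)
      rw [hw, hψ]; congr 1; ring
  rw [norm_mul, hE] at hle
  rw [neg_mul, Real.exp_neg, ← div_eq_mul_inv, le_div_iff₀ (Real.exp_pos _)]
  exact hle

/-- If `H` is holomorphic on a closed horizontal strip and decays like `exp (-ε |e^w|)` there, then
the integrals of `H(w) e^w dw` along the two boundary lines coincide. -/
theorem integral_strip_eq {a b C ε : ℝ} (hab : a ≤ b) (hε : 0 < ε) {H : ℂ → ℂ}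
    (hd : ∀ w : ℂ, w.im ∈ Icc a b → DifferentiableAt ℂ H w)
    (hH : ∀ w : ℂ, w.im ∈ Icc a b → ‖H w‖ ≤ C * Real.exp (-ε * Real.exp w.re)) :
    ∫ s : ℝ, H (s + a * Complex.I) * Complex.exp (s + a * Complex.I) =
      ∫ s : ℝ, H (s + b * Complex.I) * Complex.exp (s + b * Complex.I) := by
  set G : ℂ → ℂ := fun w => H w * Complex.exp w with hG
  have hGd : ∀ w : ℂ, w.im ∈ Icc a b → DifferentiableAt ℂ G w := fun w hw =>
    (hd w hw).mul Complex.differentiableAt_exp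
  have hGb : ∀ w : ℂ, w.im ∈ Icc a b →
      ‖G w‖ ≤ C * (Real.exp w.re * Real.exp (-ε * Real.exp w.re)) := by
    intro w hw
    rw [hG]
    simp only [norm_mul, Complex.norm_exp]
    have := hH w hw
    calc _ ≤ C * Real.exp (-ε * Real.exp w.re) * Real.exp w.re := by gcongr
      _ = _ := by ring
  have hint0 : Integrable fun s : ℝ => Real.exp s * Real.exp (-ε * Real.exp s) := by
    have h1 : IntegrableOn (fun t : ℝ => Real.exp (-ε * t)) (Ioi 0) :=
      integrableOn_exp_mul_Ioi (neg_lt_zero.2 hε) 0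
    rw [← Real.range_exp, ← image_univ, integrableOn_image_iff_integrableOn_abs_deriv_smul
      MeasurableSet.univ (fun x _ => (Real.hasDerivAt_exp x).hasDerivWithinAt)
      Real.exp_injective.injOn, integrableOn_univ] at h1
    simpa [abs_of_pos (Real.exp_pos _)] using h1
  have hint : ∀ c ∈ Icc a b, Integrable fun s : ℝ => G (s + c * Complex.I) := by
    intro c hc
    refine (hint0.const_mul C).mono' ?_ (Eventually.of_forall fun s => ?_)
    · refine Continuous.aestronglyMeasurable ?_
      rw [continuous_iff_continuousAt]
      intro s
      exact ContinuousAt.comp (f := fun s : ℝ => (s : ℂ) + c * Complex.I)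
        (hGd _ (by simpa using hc)).continuousAt (by fun_prop)
    · simpa using hGb (s + c * Complex.I) (by simpa using hc)
  have hlim : ∀ c ∈ Icc a b, Tendsto (fun T : ℝ => ∫ s in (-T)..T, G (s + c * Complex.I)) atTop
      (𝓝 (∫ s : ℝ, G (s + c * Complex.I))) := fun c hc =>
    intervalIntegral_tendsto_integral (hint c hc) tendsto_neg_atTop_atBot tendsto_id
  -- the vertical sides of the rectangle tend to `0`
  have hvert : ∀ f : ℝ → ℝ,
      Tendsto (fun T => Real.exp (f T) * Real.exp (-ε * Real.exp (f T))) atTop (𝓝 0) →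
      Tendsto (fun T : ℝ => Complex.I • ∫ y in a..b, G ((f T : ℝ) + y * Complex.I)) atTop
        (𝓝 0) := by
    intro f hf
    refine squeeze_zero_norm (a := fun T =>
      C * (Real.exp (f T) * Real.exp (-ε * Real.exp (f T))) * |b - a|) (fun T => ?_) ?_
    · rw [norm_smul, Complex.norm_I, one_mul]
      refine intervalIntegral.norm_integral_le_of_norm_le_const fun y hy => ?_
      rw [uIoc_of_le hab] at hy
      simpa using hGb ((f T : ℝ) + y * Complex.I) (by simpa using Ioc_subset_Icc_self hy)
    · simpa using (hf.const_mul C).mul_const |b - a|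
  have hlim0 : Tendsto (fun x : ℝ => x * Real.exp (-ε * x)) atTop (𝓝 0) := by
    have := Real.tendsto_pow_mul_exp_neg_atTop_nhds_zero 1
    have h2 := (this.comp (tendsto_id.const_mul_atTop hε)).const_mul ε⁻¹
    simp only [mul_zero] at h2
    refine h2.congr fun x => ?_
    simp only [Function.comp, id, pow_one]
    field_simp

  have hv1 := hvert (fun T => T) (hlim0.comp Real.tendsto_exp_atTop)
  have hv2 := hvert (fun T => -T) (by
    have h : Tendsto (fun x : ℝ => x * Real.exp (-ε * x)) (𝓝 0) (𝓝 0) := by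
      refine Continuous.tendsto' (by fun_prop) _ _ (by simp)
    exact h.comp (Real.tendsto_exp_atBot.comp tendsto_neg_atTop_atBot))
  have hzero : ∀ T : ℝ, (∫ s in (-T)..T, G (s + a * Complex.I)) -
      (∫ s in (-T)..T, G (s + b * Complex.I)) +
      Complex.I • (∫ y in a..b, G ((T : ℝ) + y * Complex.I)) -
      Complex.I • (∫ y in a..b, G ((-T : ℝ) + y * Complex.I)) = 0 := by
    intro T
    have := Complex.integral_boundary_rect_eq_zero_of_differentiableOn G (-T + a * Complex.I)
      (T + b * Complex.I) (fun w hw => (hGd w (by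
        have h := hw.2
        simpa [uIcc_of_le hab] using h)).differentiableWithinAt)
    simpa using this
  have hfin := (((hlim a ⟨le_rfl, hab⟩).sub (hlim b ⟨hab, le_rfl⟩)).add hv1).sub hv2
  have heq := tendsto_nhds_unique hfin
    ((tendsto_const_nhds (x := (0 : ℂ))).congr fun T => (hzero T).symm)
  simpa [sub_eq_zero] using heq

/-! ### The sectors and the Borel transforms on them -/

section Sector

variable {𝒜 : Set ℝ} {ρ : ℝ}

theorem norm_ofReal_mul_exp (t θ : ℝ) :
    ‖(t : ℂ) * Complex.exp (Complex.I * (θ : ℂ))‖ = |t| := by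
  rw [norm_mul, mul_comm Complex.I, Complex.norm_exp_ofReal_mul_I, mul_one, Complex.norm_real,
    Real.norm_eq_abs]

theorem ray_mem_sector {θ t : ℝ} (hθ : θ ∈ 𝒜) (ht : 0 < t) :
    (t : ℂ) * Complex.exp (Complex.I * (θ : ℂ)) ∈ sector 𝒜 ρ :=
  Or.inr ⟨t, ht, θ, hθ, rfl⟩

theorem zero_mem_sector (hρ : 0 < ρ) : (0 : ℂ) ∈ sector 𝒜 ρ :=
  Or.inl (Metric.mem_ball_self hρ)

theorem sector_mono {ρ' : ℝ} (h : ρ ≤ ρ') : sector 𝒜 ρ ⊆ sector 𝒜 ρ' :=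
  union_subset_union_left _ (Metric.ball_subset_ball h)

theorem smul_mem_sector (hρ : 0 < ρ) {ζ : ℂ} (hζ : ζ ∈ sector 𝒜 ρ) {s : ℝ}
    (hs : s ∈ Icc (0 : ℝ) 1) :
    (s : ℂ) * ζ ∈ sector 𝒜 ρ := by
  rcases hs.1.eq_or_lt with h0 | h0
  · simpa [← h0] using zero_mem_sector hρ
  rcases hζ with hζ | ⟨r, hr, θ, hθ, rfl⟩
  · left
    rw [mem_ball_zero_iff] at *
    rw [norm_mul, Complex.norm_real, Real.norm_eq_abs, abs_of_pos h0]
    nlinarith [hs.2, norm_nonneg ζ]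
  · rw [← mul_assoc, ← Complex.ofReal_mul]
    exact ray_mem_sector hθ (mul_pos h0 hr)

theorem isPreconnected_sector (hρ : 0 < ρ) : IsPreconnected (sector 𝒜 ρ) := by
  have h : StarConvex ℝ (0 : ℂ) (sector 𝒜 ρ) := by
    rw [starConvex_zero_iff]
    intro ζ hζ s hs hs'
    simpa using smul_mem_sector hρ hζ ⟨hs, hs'⟩
  exact (h.isPathConnected (zero_mem_sector hρ)).isConnected.isPreconnected

theorem eqOn_sector_of_eventuallyEq (hopen : IsOpen (sector 𝒜 ρ)) (hρ : 0 < ρ) {g g' : ℂ → ℂ}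
    (hg : DifferentiableOn ℂ g (sector 𝒜 ρ)) (hg' : DifferentiableOn ℂ g' (sector 𝒜 ρ))
    {z : ℂ} (hz : z ∈ sector 𝒜 ρ) (h : g =ᶠ[𝓝 z] g') : EqOn g g' (sector 𝒜 ρ) :=
  (hg.analyticOnNhd hopen).eqOn_of_preconnected_of_eventuallyEq (hg'.analyticOnNhd hopen)
    (isPreconnected_sector hρ) hz h

/-- The analytic continuation of a Borel transform is unique. -/
theorem IsBorelExtension.eqOn (hopen : ∀ r : ℝ, 0 < r → IsOpen (sector 𝒜 r)) {ρ' : ℝ}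
    (hρ : 0 < ρ) (hρ' : 0 < ρ') {φ : ℂ⟦X⟧} {g g' : ℂ → ℂ} (hg : IsBorelExtension 𝒜 ρ φ g)
    (hg' : IsBorelExtension 𝒜 ρ' φ g') : EqOn g g' (sector 𝒜 (min ρ ρ')) := by
  have hm : 0 < min ρ ρ' := lt_min hρ hρ'
  refine eqOn_sector_of_eventuallyEq (hopen _ hm) hm (hg.1.mono (sector_mono (min_le_left _ _)))
    (hg'.1.mono (sector_mono (min_le_right _ _))) (zero_mem_sector hm) ?_
  filter_upwards [Metric.ball_mem_nhds (0 : ℂ) hm] with ζ hζ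
  exact (hg.2 ζ (Metric.ball_subset_ball (min_le_left _ _) hζ)).unique
    (hg'.2 ζ (Metric.ball_subset_ball (min_le_right _ _) hζ))

theorem borelFun_ray (hopen : ∀ r : ℝ, 0 < r → IsOpen (sector 𝒜 r)) (hρ : 0 < ρ) {φ : ℂ⟦X⟧}
    {g : ℂ → ℂ} (hg : IsBorelExtension 𝒜 ρ φ g) {θ t : ℝ} (hθ : θ ∈ 𝒜) (ht : 0 < t) :
    borelFun 𝒜 φ ((t : ℂ) * Complex.exp (Complex.I * (θ : ℂ))) =
      g ((t : ℂ) * Complex.exp (Complex.I * (θ : ℂ))) := by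
  obtain ⟨ρ', hρ', h⟩ : ∃ ρ' : ℝ, 0 < ρ' ∧ IsBorelExtension 𝒜 ρ' φ (borelFun 𝒜 φ) :=
    Classical.epsilon_spec (p := fun g => ∃ ρ : ℝ, 0 < ρ ∧ IsBorelExtension 𝒜 ρ φ g)
      ⟨g, ρ, hρ, hg⟩
  exact h.eqOn hopen hρ' hρ hg (ray_mem_sector hθ ht)

/-- The Taylor coefficients of an analytic continuation at `0` determine the series. -/
theorem IsBorelExtension.coeff_succ (hρ : 0 < ρ) {φ : ℂ⟦X⟧} {g : ℂ → ℂ}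
    (hg : IsBorelExtension 𝒜 ρ φ g) (n : ℕ) :
    PowerSeries.coeff (n + 1) φ = iteratedDeriv n g 0 := by
  have hd : DifferentiableOn ℂ g (Metric.ball 0 ρ) := hg.1.mono subset_union_left
  lift ρ to NNReal using hρ.le
  have hρ' : 0 < ρ := by exact_mod_cast hρ
  have h1 : HasFPowerSeriesOnBall g (FormalMultilinearSeries.ofScalars ℂ
      fun n => PowerSeries.coeff n (borelTransform φ)) 0 ρ := by
    have hs : ∀ ζ ∈ Metric.ball (0 : ℂ) ρ, HasSum (fun n => FormalMultilinearSeries.ofScalars ℂ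
        (fun n => PowerSeries.coeff n (borelTransform φ)) n fun _ => ζ) (g ζ) := by
      intro ζ hζ
      simpa [FormalMultilinearSeries.ofScalars_apply_eq, mul_comm] using hg.2 ζ hζ
    refine ⟨?_, by exact_mod_cast hρ', fun {y} hy => ?_⟩
    · refine ENNReal.le_of_forall_nnreal_lt fun r hr => ?_
      refine FormalMultilinearSeries.le_radius_of_tendsto _ (l := 0) ?_
      have hr' : (r : ℂ) ∈ Metric.ball (0 : ℂ) ρ := by
        have : r < ρ := by exact_mod_cast hr
        simpa using this
      have := (hg.2 _ hr').summable.tendsto_atTop_zero.norm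
      simpa [FormalMultilinearSeries.ofScalars_norm] using this
    · rw [zero_add]
      exact hs y (by simpa [Metric.eball_coe] using hy)
  have h2 := h1.hasFPowerSeriesAt.eq_formalMultilinearSeries
    (hd.analyticAt (Metric.ball_mem_nhds _ hρ')).hasFPowerSeriesAt
  have h3 := congrArg (fun p => p.coeff n) h2
  simp only [FormalMultilinearSeries.coeff_ofScalars, borelTransform, PowerSeries.coeff_mk] at h3
  exact (div_left_inj' (Nat.cast_ne_zero.2 n.factorial_ne_zero)).1 h3

/-- A holomorphic function on `S(ρ, 𝒜)` and a constant term come from a series. -/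
theorem exists_isBorelExtension (c : ℂ) {g : ℂ → ℂ}
    (hg : DifferentiableOn ℂ g (sector 𝒜 ρ)) :
    ∃ φ : ℂ⟦X⟧, PowerSeries.constantCoeff φ = c ∧ IsBorelExtension 𝒜 ρ φ g := by
  refine ⟨PowerSeries.mk fun n => n.casesOn c fun n => iteratedDeriv n g 0, by simp, hg, ?_⟩
  intro ζ hζ
  refine (Complex.hasSum_taylorSeries_on_ball (hg.mono subset_union_left) hζ).congr_fun ?_
  intro n
  simp [borelTransform]
  ring

/-- The bound of `expNorm` holds for any analytic continuation, by uniqueness. -/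
theorem exists_of_expNorm_le (hopen : ∀ r : ℝ, 0 < r → IsOpen (sector 𝒜 r)) (hρ : 0 < ρ)
    {τ C : ℝ} (hC : 0 ≤ C) {φ : ℂ⟦X⟧} (h : expNorm 𝒜 ρ τ φ ≤ ENNReal.ofReal C) :
    ∃ g, IsBorelExtension 𝒜 ρ φ g ∧ ‖PowerSeries.constantCoeff φ‖ ≤ C ∧
      ∀ ζ ∈ sector 𝒜 ρ, ‖g ζ‖ ≤ C * Real.exp (τ * ‖ζ‖) := by
  have hne : ∃ g, IsBorelExtension 𝒜 ρ φ g := by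
    by_contra! hne
    simp [expNorm, hne] at h
  obtain ⟨g, hg⟩ := hne
  have hle : ENNReal.ofReal ‖PowerSeries.constantCoeff φ‖ +
      ⨆ ζ ∈ sector 𝒜 ρ, ENNReal.ofReal (Real.exp (-τ * ‖ζ‖) * ‖g ζ‖) ≤ ENNReal.ofReal C := by
    refine le_trans (le_iInf₂ fun g' hg' => ?_) h
    gcongr with ζ hζ
    rw [hg.eqOn hopen hρ hρ hg' (by rwa [min_self])]
  refine ⟨g, hg, ?_, fun ζ hζ => ?_⟩
  · exact (ENNReal.ofReal_le_ofReal_iff hC).1 (le_self_add.trans hle)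
  · have h1 : ENNReal.ofReal (Real.exp (-τ * ‖ζ‖) * ‖g ζ‖) ≤ ENNReal.ofReal C :=
      (le_iSup₂ (f := fun ζ (_ : ζ ∈ sector 𝒜 ρ) =>
        ENNReal.ofReal (Real.exp (-τ * ‖ζ‖) * ‖g ζ‖)) ζ hζ).trans (le_add_self.trans hle)
    rw [ENNReal.ofReal_le_ofReal_iff hC, neg_mul, Real.exp_neg, inv_mul_le_iff₀ (Real.exp_pos _)]
      at h1
    linarith

end Sector

/-! ### Laplace transforms -/

section Laplace

variable {𝒜 : Set ℝ} {ρ τ C : ℝ} {g : ℂ → ℂ}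

theorem norm_laplaceIntegrand (g : ℂ → ℂ) (θ : ℝ) (z : ℂ) (t : ℝ) :
    ‖laplaceIntegrand g θ z t‖ = ‖g ((t : ℂ) * Complex.exp (Complex.I * (θ : ℂ)))‖ *
      Real.exp (-(z * Complex.exp (Complex.I * (θ : ℂ))).re * t) := by
  rw [laplaceIntegrand, norm_mul, norm_mul, mul_comm Complex.I, Complex.norm_exp_ofReal_mul_I,
    mul_one, Complex.norm_exp]
  congr 2
  rw [mul_left_comm, ← mul_neg, Complex.re_ofReal_mul, Complex.neg_re]
  ring

theorem norm_laplaceIntegrand_le (hb : ∀ ζ ∈ sector 𝒜 ρ, ‖g ζ‖ ≤ C * Real.exp (τ * ‖ζ‖))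
    {θ : ℝ} (hθ : θ ∈ 𝒜) (z : ℂ) {t : ℝ} (ht : 0 < t) :
    ‖laplaceIntegrand g θ z t‖ ≤
      C * Real.exp (-((z * Complex.exp (Complex.I * (θ : ℂ))).re - τ) * t) := by
  rw [norm_laplaceIntegrand]
  have h := hb _ (ray_mem_sector (ρ := ρ) hθ ht)
  rw [norm_ofReal_mul_exp, abs_of_pos ht] at h
  calc _ ≤ C * Real.exp (τ * t) *
        Real.exp (-(z * Complex.exp (Complex.I * (θ : ℂ))).re * t) := by gcongr
    _ = _ := by rw [mul_assoc, ← Real.exp_add]; ring_nf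

theorem continuousOn_laplaceIntegrand (hg : ContinuousOn g (sector 𝒜 ρ)) {θ : ℝ} (hθ : θ ∈ 𝒜)
    (z : ℂ) : ContinuousOn (laplaceIntegrand g θ z) (Ioi 0) := by
  unfold laplaceIntegrand
  refine ContinuousOn.mul (ContinuousOn.mul ?_ (by fun_prop)) (by fun_prop)
  exact hg.comp (by fun_prop) fun t ht => ray_mem_sector hθ ht

theorem integrableOn_laplaceIntegrand (hg : ContinuousOn g (sector 𝒜 ρ))
    (hb : ∀ ζ ∈ sector 𝒜 ρ, ‖g ζ‖ ≤ C * Real.exp (τ * ‖ζ‖)) {θ : ℝ} (hθ : θ ∈ 𝒜) {z : ℂ}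
    (hz : τ < (z * Complex.exp (Complex.I * (θ : ℂ))).re) :
    IntegrableOn (laplaceIntegrand g θ z) (Ioi 0) := by
  refine ((integrableOn_exp_mul_Ioi (neg_lt_zero.2 (sub_pos.2 hz)) 0).const_mul C).mono'
    ((continuousOn_laplaceIntegrand hg hθ z).aestronglyMeasurable measurableSet_Ioi) ?_
  filter_upwards [self_mem_ae_restrict measurableSet_Ioi] with t ht
  exact norm_laplaceIntegrand_le hb hθ z ht

theorem norm_laplace_le
    (hb : ∀ ζ ∈ sector 𝒜 ρ, ‖g ζ‖ ≤ C * Real.exp (τ * ‖ζ‖)) {θ : ℝ} (hθ : θ ∈ 𝒜) {z : ℂ}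
    (hz : τ < (z * Complex.exp (Complex.I * (θ : ℂ))).re) :
    ‖laplace g θ z‖ ≤ C / ((z * Complex.exp (Complex.I * (θ : ℂ))).re - τ) := by
  have h := norm_integral_le_of_norm_le (f := laplaceIntegrand g θ z)
    ((integrableOn_exp_mul_Ioi (neg_lt_zero.2 (sub_pos.2 hz)) 0).const_mul C) (by
      filter_upwards [self_mem_ae_restrict measurableSet_Ioi] with t ht
      exact norm_laplaceIntegrand_le hb hθ z ht)
  rw [integral_const_mul, integral_exp_mul_Ioi (neg_lt_zero.2 (sub_pos.2 hz))] at h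
  refine h.trans_eq ?_
  rw [mul_zero, Real.exp_zero, neg_div_neg_eq, mul_one_div]

theorem laplace_congr {g' : ℂ → ℂ} {θ : ℝ}
    (h : ∀ t : ℝ, 0 < t → g ((t : ℂ) * Complex.exp (Complex.I * (θ : ℂ))) =
      g' ((t : ℂ) * Complex.exp (Complex.I * (θ : ℂ)))) (z : ℂ) :
    EqOn (laplaceIntegrand g θ z) (laplaceIntegrand g' θ z) (Ioi 0) ∧
      laplace g θ z = laplace g' θ z := by
  have h1 : EqOn (laplaceIntegrand g θ z) (laplaceIntegrand g' θ z) (Ioi 0) := by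
    intro t ht
    rw [laplaceIntegrand, laplaceIntegrand, h t ht]
  exact ⟨h1, setIntegral_congr_fun measurableSet_Ioi h1⟩

theorem isOpen_halfPlane (τ θ : ℝ) :
    IsOpen {z : ℂ | τ < (z * Complex.exp (Complex.I * (θ : ℂ))).re} :=
  isOpen_lt continuous_const (by fun_prop)

theorem differentiableOn_laplace (hg : ContinuousOn g (sector 𝒜 ρ))
    (hb : ∀ ζ ∈ sector 𝒜 ρ, ‖g ζ‖ ≤ C * Real.exp (τ * ‖ζ‖)) {θ : ℝ} (hθ : θ ∈ 𝒜) :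
    DifferentiableOn ℂ (laplace g θ)
      {z : ℂ | τ < (z * Complex.exp (Complex.I * (θ : ℂ))).re} := by
  intro z₀ hz₀
  obtain ⟨m, hm, hm'⟩ := exists_between (show τ < _ from hz₀)
  have hC : 0 ≤ C := by
    have := (norm_nonneg _).trans (hb _ (ray_mem_sector hθ zero_lt_one))
    exact nonneg_of_mul_nonneg_left this (Real.exp_pos _)
  refine DifferentiableAt.differentiableWithinAt ?_
  refine DifferentiableOn.differentiableAt ?_ ((isOpen_halfPlane m θ).mem_nhds hm')
  refine differentiableOn_integral (isOpen_halfPlane m θ)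
    (b := fun t => C * Real.exp (-(m - τ) * t)) (fun z hz =>
      (integrableOn_laplaceIntegrand hg hb hθ (hm.trans hz)).aestronglyMeasurable) ?_ ?_
    ((integrableOn_exp_mul_Ioi (neg_lt_zero.2 (sub_pos.2 hm)) 0).const_mul C)
  · refine Eventually.of_forall fun t => Differentiable.differentiableOn ?_
    unfold laplaceIntegrand
    fun_prop
  · filter_upwards [self_mem_ae_restrict measurableSet_Ioi] with t ht z hz
    refine (norm_laplaceIntegrand_le hb hθ z ht).trans ?_
    have ht' : (0 : ℝ) < t := ht
    have hz' : m < (z * Complex.exp (Complex.I * (θ : ℂ))).re := hz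
    gcongr

/-- The Laplace integral along a ray, in the variable `log ζ`. -/
theorem laplace_eq_integral_exp (g : ℂ → ℂ) (θ : ℝ) (z : ℂ) :
    laplace g θ z = ∫ s : ℝ, (fun w => g (Complex.exp w) * Complex.exp (-(z * Complex.exp w)))
      (s + θ * Complex.I) * Complex.exp (s + θ * Complex.I) := by
  rw [laplace, ← Real.range_exp, ← image_univ, integral_image_eq_integral_abs_deriv_smul
    MeasurableSet.univ (fun x _ => (Real.hasDerivAt_exp x).hasDerivWithinAt)
    Real.exp_injective.injOn, setIntegral_univ]
  congr 1 with s
  simp only [abs_of_pos (Real.exp_pos _), laplaceIntegrand, Complex.real_smul, Complex.exp_add,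
    Complex.ofReal_exp, mul_comm Complex.I]
  ring

theorem exp_mem_sector {w : ℂ} (hw : w.im ∈ 𝒜) : Complex.exp w ∈ sector 𝒜 ρ := by
  have := ray_mem_sector (ρ := ρ) hw (Real.exp_pos w.re)
  rwa [Complex.ofReal_exp, ← Complex.exp_add, mul_comm Complex.I, Complex.re_add_im] at this

theorem differentiableAt_comp_exp (hopen : IsOpen (sector 𝒜 ρ))
    (hg : DifferentiableOn ℂ g (sector 𝒜 ρ)) (z : ℂ) {w : ℂ} (hw : w.im ∈ 𝒜) :
    DifferentiableAt ℂ (fun w => g (Complex.exp w) * Complex.exp (-(z * Complex.exp w))) w := by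
  have h : DifferentiableAt ℂ g (Complex.exp w) :=
    hg.differentiableAt (hopen.mem_nhds (exp_mem_sector hw))
  have h2 : DifferentiableAt ℂ (fun w => g (Complex.exp w)) w :=
    h.comp w Complex.differentiableAt_exp
  fun_prop

/-- The Laplace transforms in two directions making an angle less than `π` coincide where both are
defined. In the sector between both rays, the integrand decays by Phragmén–Lindelöf, even where
the intermediate directions are not admissible. -/
theorem laplace_eq_laplace (h𝒜 : 𝒜.OrdConnected) (hopen : IsOpen (sector 𝒜 ρ))
    (hg : DifferentiableOn ℂ g (sector 𝒜 ρ))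
    (hb : ∀ ζ ∈ sector 𝒜 ρ, ‖g ζ‖ ≤ C * Real.exp (τ * ‖ζ‖)) {a b : ℝ} (ha : a ∈ 𝒜) (hb' : b ∈ 𝒜)
    (hab : |a - b| < Real.pi) {z : ℂ}
    (hza : τ < (z * Complex.exp (Complex.I * (a : ℂ))).re)
    (hzb : τ < (z * Complex.exp (Complex.I * (b : ℂ))).re) :
    laplace g a z = laplace g b z := by
  wlog hle : a < b generalizing a b
  · rcases (not_lt.1 hle).eq_or_lt with h | h
    · rw [h]
    · exact (this hb' ha (by rwa [abs_sub_comm]) hzb hza h).symm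
  rw [abs_sub_comm, abs_of_pos (sub_pos.2 hle)] at hab
  set H : ℂ → ℂ := fun w => g (Complex.exp w) * Complex.exp (-(z * Complex.exp w)) with hH
  have hC : 0 ≤ C := by
    have := (norm_nonneg _).trans (hb _ (ray_mem_sector ha zero_lt_one))
    exact nonneg_of_mul_nonneg_left this (Real.exp_pos _)
  have hsub : Icc a b ⊆ 𝒜 := h𝒜.out ha hb'
  have hHn : ∀ w : ℂ, w.im ∈ Icc a b → ‖H w‖ ≤ C * Real.exp
      ((τ - (z * Complex.exp (Complex.I * (w.im : ℂ))).re) * Real.exp w.re) := by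
    intro w hw
    have h1 := hb _ (exp_mem_sector (ρ := ρ) (hsub hw))
    rw [Complex.norm_exp] at h1
    rw [hH]
    simp only [norm_mul]
    have h2 : (-(z * Complex.exp w)).re =
        -(z * Complex.exp (Complex.I * (w.im : ℂ))).re * Real.exp w.re := by
      conv_lhs => rw [← Complex.re_add_im w, Complex.exp_add, ← Complex.ofReal_exp,
        mul_left_comm, mul_comm (w.im : ℂ), Complex.neg_re, Complex.re_ofReal_mul]
      ring
    rw [Complex.norm_exp (-(z * Complex.exp w)), h2]
    calc _ ≤ C * Real.exp (τ * Real.exp w.re) *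
          Real.exp (-(z * Complex.exp (Complex.I * (w.im : ℂ))).re * Real.exp w.re) := by gcongr
      _ = _ := by rw [mul_assoc, ← Real.exp_add]; ring_nf
  have hd : ∀ w : ℂ, w.im ∈ Icc a b → DifferentiableAt ℂ H w := fun w hw =>
    differentiableAt_comp_exp hopen hg z (hsub hw)
  obtain ⟨δ, hδ, hδa, hδb⟩ : ∃ δ : ℝ, 0 < δ ∧
      δ ≤ (z * Complex.exp (Complex.I * (a : ℂ))).re - τ ∧
      δ ≤ (z * Complex.exp (Complex.I * (b : ℂ))).re - τ :=
    ⟨min _ _, lt_min (sub_pos.2 hza) (sub_pos.2 hzb), min_le_left _ _, min_le_right _ _⟩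
  have key : ∀ w : ℂ, w.im ∈ Icc a b → ‖H w‖ ≤ C * Real.exp (-δ * Real.exp w.re) := by
    intro w hw
    refine (norm_le_of_decay_boundary hle hab hδ.le hd (K := |τ| + ‖z‖) (C := C) ?_ ?_ ?_
      hw).trans ?_
    · intro w hw
      refine (hHn w hw).trans ?_
      have h1 : |(z * Complex.exp (Complex.I * (w.im : ℂ))).re| ≤ ‖z‖ := by
        refine (Complex.abs_re_le_norm _).trans_eq ?_
        rw [norm_mul, mul_comm Complex.I, Complex.norm_exp_ofReal_mul_I, mul_one]
      gcongr
      linarith [le_abs_self τ, neg_abs_le (z * Complex.exp (Complex.I * (w.im : ℂ))).re]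
    · intro w hw
      refine (hHn w (by rw [hw]; exact ⟨le_rfl, hle.le⟩)).trans ?_
      rw [hw]
      gcongr
      linarith
    · intro w hw
      refine (hHn w (by rw [hw]; exact ⟨hle.le, le_rfl⟩)).trans ?_
      rw [hw]
      gcongr
      linarith
    · have hcos : 0 < Real.cos ((b - a) / 2) :=
        Real.cos_pos_of_mem_Ioo ⟨by linarith [Real.pi_pos], by linarith⟩
      have h2 : Real.cos ((b - a) / 2) ≤ Real.cos (w.im - (a + b) / 2) := by
        rw [← Real.cos_abs (w.im - _)]
        refine Real.cos_le_cos_of_nonneg_of_le_pi (abs_nonneg _) (by linarith) ?_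
        rw [abs_le]
        constructor <;> linarith [hw.1, hw.2]
      refine mul_le_mul_of_nonneg_left (Real.exp_le_exp.2 ?_) hC
      rw [neg_mul, neg_mul, neg_le_neg_iff, div_mul_eq_mul_div, le_div_iff₀ hcos, mul_assoc]
      gcongr
  rw [laplace_eq_integral_exp, laplace_eq_integral_exp]
  exact integral_strip_eq hle.le hδ hd key

/-- A holomorphic function which decays exponentially in a sector of opening at least `π`
vanishes. -/
theorem eqOn_zero_of_decay {ψ : ℝ} (h𝒜 : Ioo (ψ - Real.pi / 2) (ψ + Real.pi / 2) ⊆ 𝒜)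
    (hρ : 0 < ρ) (hopen : IsOpen (sector 𝒜 ρ)) (hg : DifferentiableOn ℂ g (sector 𝒜 ρ))
    (hτ : τ < 0) (hb : ∀ ζ ∈ sector 𝒜 ρ, ‖g ζ‖ ≤ C * Real.exp (τ * ‖ζ‖)) :
    EqOn g 0 (sector 𝒜 ρ) := by
  have hψ : ψ ∈ 𝒜 := h𝒜 ⟨by linarith [Real.pi_pos], by linarith [Real.pi_pos]⟩
  have hray : ∀ w : ℂ, w.im = ψ → g (Complex.exp w) = 0 := by
    intro w hw
    have hbd : ∀ β ∈ Ioo 0 (Real.pi / 2), ‖g (Complex.exp w)‖ ≤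
        C * Real.exp (τ * Real.exp w.re / Real.cos β) := by
      intro β hβ
      have hsub : Icc (ψ - β) (ψ + β) ⊆ 𝒜 :=
        (Icc_subset_Ioo (by linarith [hβ.2]) (by linarith [hβ.2])).trans h𝒜
      have hle : ∀ w : ℂ, w.im ∈ Icc (ψ - β) (ψ + β) →
          ‖g (Complex.exp w)‖ ≤ C * Real.exp (τ * Real.exp w.re) := by
        intro w hw
        have := hb _ (exp_mem_sector (ρ := ρ) (hsub hw))
        rwa [Complex.norm_exp] at this
      have := norm_le_of_decay_boundary (a := ψ - β) (b := ψ + β) (K := τ) (C := C) (δ := -τ)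
        (H := fun w => g (Complex.exp w)) (by linarith [hβ.1]) (by linarith [hβ.2])
        (by linarith) (fun w hw => by
          simpa using differentiableAt_comp_exp hopen hg 0 (hsub hw)) hle
        (fun w hw => by
          rw [neg_neg]; exact hle w (by rw [hw]; constructor <;> linarith [hβ.1]))
        (fun w hw => by
          rw [neg_neg]; exact hle w (by rw [hw]; constructor <;> linarith [hβ.1]))
        (w := w) (by rw [hw]; constructor <;> linarith [hβ.1])
      refine this.trans_eq ?_
      have e1 : (ψ + β - (ψ - β)) / 2 = β := by ring
      have e2 : w.im - (ψ - β + (ψ + β)) / 2 = 0 := by rw [hw]; ring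
      rw [e1, e2, Real.cos_zero]
      congr 2
      ring
    have hlim : Tendsto (fun β => C * Real.exp (τ * Real.exp w.re / Real.cos β))
        (𝓝[<] (Real.pi / 2)) (𝓝 0) := by
      have h1 := Real.tendsto_cos_pi_div_two
      have h2 : Tendsto (fun β => τ * Real.exp w.re / Real.cos β) (𝓝[<] (Real.pi / 2)) atBot := by
        simp only [div_eq_mul_inv]
        exact (tendsto_inv_nhdsGT_zero.comp h1).const_mul_atTop_of_neg
          (mul_neg_of_neg_of_pos hτ (Real.exp_pos _))
      simpa using (Real.tendsto_exp_atBot.comp h2).const_mul C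
    refine norm_le_zero_iff.1 (ge_of_tendsto hlim ?_)
    filter_upwards [Ioo_mem_nhdsLT (by positivity : (0 : ℝ) < Real.pi / 2)] with β hβ
    exact hbd β hβ
  have hcl : ∃ᶠ ζ in 𝓝[≠] (0 : ℂ), g ζ = (0 : ℂ → ℂ) ζ := by
    have ht : Tendsto (fun s : ℝ => Complex.exp (s + ψ * Complex.I)) atBot (𝓝[≠] 0) := by
      rw [tendsto_nhdsWithin_iff]
      refine ⟨?_, Eventually.of_forall fun s => Complex.exp_ne_zero _⟩
      rw [tendsto_zero_iff_norm_tendsto_zero]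
      simpa [Complex.norm_exp] using Real.tendsto_exp_atBot
    exact ht.frequently (Eventually.of_forall fun s => hray _ (by simp)).frequently
  have hz := zero_mem_sector (𝒜 := 𝒜) hρ
  exact (hg.analyticOnNhd hopen).eqOn_of_preconnected_of_frequently_eq
    (fun z _ => analyticAt_const) (isPreconnected_sector hρ) hz hcl

/-- An interval of length at least `π` contains an open interval of length `π`. -/
theorem exists_Ioo_subset_of_pi_le_volume (h𝒜 : 𝒜.OrdConnected)
    (hv : ENNReal.ofReal Real.pi ≤ volume 𝒜) :
    ∃ ψ : ℝ, Ioo (ψ - Real.pi / 2) (ψ + Real.pi / 2) ⊆ 𝒜 := by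
  have hpi := Real.pi_pos
  have hne : 𝒜.Nonempty := by
    by_contra! h
    simp [h, not_le.2 hpi] at hv
  by_cases hA : BddAbove 𝒜
  · by_cases hB : BddBelow 𝒜
    · have hsub : 𝒜 ⊆ Icc (sInf 𝒜) (sSup 𝒜) := subset_Icc_csInf_csSup hB hA
      have hlen : Real.pi ≤ sSup 𝒜 - sInf 𝒜 := by
        have h := hv.trans (measure_mono hsub)
        rw [Real.volume_Icc] at h
        by_contra! hlt
        exact absurd h (not_le.2 ((ENNReal.ofReal_lt_ofReal_iff hpi).2 hlt))
      refine ⟨sInf 𝒜 + Real.pi / 2, fun x hx => ?_⟩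
      obtain ⟨a, ha, hax⟩ := exists_lt_of_csInf_lt hne (show sInf 𝒜 < x by linarith [hx.1])
      obtain ⟨b, hb, hxb⟩ := exists_lt_of_lt_csSup hne (show x < sSup 𝒜 by linarith [hx.2])
      exact h𝒜.out ha hb ⟨hax.le, hxb.le⟩
    · obtain ⟨b, hb⟩ := hne
      refine ⟨b - Real.pi / 2, fun x hx => ?_⟩
      obtain ⟨a, ha, hax⟩ := not_bddBelow_iff.1 hB x
      exact h𝒜.out ha hb ⟨hax.le, by linarith [hx.2]⟩
  · obtain ⟨a, ha⟩ := hne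
    refine ⟨a + Real.pi / 2, fun x hx => ?_⟩
    obtain ⟨b, hb, hxb⟩ := not_bddAbove_iff.1 hA x
    exact h𝒜.out ha hb ⟨by linarith [hx.1], hxb.le⟩

end Laplace

/-! ### Borel sums -/

section BorelSum

variable {𝒜 : Set ℝ} {ρ τ σ C : ℝ} {g : ℂ → ℂ} {φ : ℂ⟦X⟧}

/-- Two admissible directions make an angle less than `π`, except in the planar case with a
negative parameter. -/
theorem abs_sub_lt_pi_of_mem_directions (h𝒜 : 𝒜.OrdConnected) {p : ℂ} {a b : ℝ}
    (ha : a ∈ directions 𝒜 σ p) (hb : b ∈ directions 𝒜 σ p)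
    (h : ¬(σ < 0 ∧ ENNReal.ofReal Real.pi ≤ volume 𝒜)) : |a - b| < Real.pi := by
  by_cases hlog : OnLogSurface 𝒜 σ
  · have h1 := abs_lt.1 (ha.2.2 hlog)
    have h2 := abs_lt.1 (hb.2.2 hlog)
    rw [abs_lt]
    constructor <;> linarith [h1.1, h1.2, h2.1, h2.2]
  · have hvol : volume 𝒜 < ENNReal.ofReal Real.pi := by
      by_contra! hv
      exact h ⟨not_le.1 fun h0 => hlog ⟨h0, hv⟩, hv⟩
    wlog hab : b ≤ a generalizing a b
    · rw [abs_sub_comm]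
      exact this hb ha (le_of_not_ge hab)
    rw [abs_of_nonneg (sub_nonneg.2 hab), ← ENNReal.ofReal_lt_ofReal_iff Real.pi_pos,
      ← Real.volume_Icc]
    exact (measure_mono (h𝒜.out hb.1 ha.1)).trans_lt hvol

theorem laplace_eq_of_mem_directions (h𝒜 : 𝒜.OrdConnected) (hρ : 0 < ρ)
    (hopen : IsOpen (sector 𝒜 ρ)) (hg : DifferentiableOn ℂ g (sector 𝒜 ρ))
    (hb : ∀ ζ ∈ sector 𝒜 ρ, ‖g ζ‖ ≤ C * Real.exp (τ * ‖ζ‖)) (hσ : τ ≤ σ) {p : ℂ} {θ θ' : ℝ}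
    (hθ : θ ∈ directions 𝒜 σ p) (hθ' : θ' ∈ directions 𝒜 σ p) :
    laplace g θ (proj 𝒜 σ p) = laplace g θ' (proj 𝒜 σ p) := by
  by_cases h : σ < 0 ∧ ENNReal.ofReal Real.pi ≤ volume 𝒜
  · obtain ⟨ψ, hψ⟩ := exists_Ioo_subset_of_pi_le_volume h𝒜 h.2
    have h0 := eqOn_zero_of_decay hψ hρ hopen hg (hσ.trans_lt h.1) hb
    have hz : ∀ {θ}, θ ∈ 𝒜 → laplace g θ (proj 𝒜 σ p) = laplace 0 θ (proj 𝒜 σ p) := fun hθ =>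
      (laplace_congr (fun t ht => h0 (ray_mem_sector hθ ht)) _).2
    rw [hz hθ.1, hz hθ'.1]
    simp [laplace, laplaceIntegrand]
  · exact laplace_eq_laplace h𝒜 hopen hg hb hθ.1 hθ'.1
      (abs_sub_lt_pi_of_mem_directions h𝒜 hθ hθ' h) (hσ.trans_lt hθ.2.1) (hσ.trans_lt hθ'.2.1)

theorem borelSum_eq (h𝒜 : 𝒜.OrdConnected) (hopen : ∀ r : ℝ, 0 < r → IsOpen (sector 𝒜 r))
    (hρ : 0 < ρ) (hg : IsBorelExtension 𝒜 ρ φ g)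
    (hb : ∀ ζ ∈ sector 𝒜 ρ, ‖g ζ‖ ≤ C * Real.exp (τ * ‖ζ‖)) (hσ : τ ≤ σ) {p : ℂ} {θ : ℝ}
    (hθ : θ ∈ directions 𝒜 σ p) :
    borelSum 𝒜 σ φ p = PowerSeries.constantCoeff φ + laplace g θ (proj 𝒜 σ p) := by
  have he : Classical.epsilon (fun θ => θ ∈ directions 𝒜 σ p) ∈ directions 𝒜 σ p :=
    Classical.epsilon_spec (p := fun θ => θ ∈ directions 𝒜 σ p) ⟨θ, hθ⟩
  rw [borelSum, (laplace_congr (fun t ht => borelFun_ray hopen hρ hg he.1 ht) _).2,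
    laplace_eq_of_mem_directions h𝒜 hρ (hopen ρ hρ) hg.1 hb hσ he hθ]

theorem borelSumWellDefined (h𝒜 : 𝒜.OrdConnected)
    (hopen : ∀ r : ℝ, 0 < r → IsOpen (sector 𝒜 r))
    (hρ : 0 < ρ) (hg : IsBorelExtension 𝒜 ρ φ g)
    (hb : ∀ ζ ∈ sector 𝒜 ρ, ‖g ζ‖ ≤ C * Real.exp (τ * ‖ζ‖)) (hσ : τ ≤ σ) :
    BorelSumWellDefined 𝒜 σ φ := by
  intro p θ hθ
  obtain ⟨h1, h2⟩ := laplace_congr (fun t ht => borelFun_ray hopen hρ hg hθ.1 ht) (proj 𝒜 σ p)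
  refine ⟨?_, ?_⟩
  · exact (integrableOn_laplaceIntegrand hg.1.continuousOn hb hθ.1
      (hσ.trans_lt hθ.2.1)).congr_fun h1.symm measurableSet_Ioi
  · rw [borelSum_eq h𝒜 hopen hρ hg hb hσ hθ, h2]

theorem differentiable_proj : Differentiable ℂ (proj 𝒜 σ) := by
  unfold proj
  split_ifs
  · exact Complex.differentiable_exp
  · exact differentiable_id

/-- Near any point of `Σ^𝒜_σ`, all Borel sums can be computed in one fixed direction, whence
holomorphy and a uniform bound. -/
theorem exists_nhds_borelSum (h𝒜 : 𝒜.OrdConnected)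
    (hopen : ∀ r : ℝ, 0 < r → IsOpen (sector 𝒜 r)) (hρ : 0 < ρ) (hσ : τ ≤ σ) {p₀ : ℂ}
    (hp₀ : p₀ ∈ sumDomain 𝒜 σ) :
    ∃ η > 0, ∃ V : Set ℂ, IsOpen V ∧ p₀ ∈ V ∧ ∀ (φ : ℂ⟦X⟧) (g : ℂ → ℂ) (C : ℝ),
      IsBorelExtension 𝒜 ρ φ g → (∀ ζ ∈ sector 𝒜 ρ, ‖g ζ‖ ≤ C * Real.exp (τ * ‖ζ‖)) →
      DifferentiableOn ℂ (borelSum 𝒜 σ φ) V ∧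
      ∀ p ∈ V, ‖borelSum 𝒜 σ φ p‖ ≤ ‖PowerSeries.constantCoeff φ‖ + C / η := by
  obtain ⟨θ, hθ, hx, hlog⟩ := hp₀
  obtain ⟨m, hm, hm'⟩ := exists_between hx
  set V : Set ℂ := {p | m < (proj 𝒜 σ p * Complex.exp (Complex.I * (θ : ℂ))).re} ∩
    {p | OnLogSurface 𝒜 σ → |p.im + θ| < Real.pi / 2} with hV
  have hdir : ∀ p ∈ V, θ ∈ directions 𝒜 σ p := fun p hp => ⟨hθ, hm.trans hp.1, hp.2⟩
  have hVo : IsOpen V := by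
    refine IsOpen.inter ?_ ?_
    · exact (isOpen_halfPlane m θ).preimage differentiable_proj.continuous
    · by_cases h : OnLogSurface 𝒜 σ
      · simp only [h, true_imp_iff]
        exact isOpen_lt (by fun_prop) continuous_const
      · simp [h]
  refine ⟨m - τ, by linarith, V, hVo, ⟨hm', hlog⟩, fun φ g C hg hb => ⟨?_, fun p hp => ?_⟩⟩
  · have h1 : DifferentiableOn ℂ (fun p => PowerSeries.constantCoeff φ +
        laplace g θ (proj 𝒜 σ p)) V := by
      refine (differentiableOn_const _).add ?_
      exact (differentiableOn_laplace hg.1.continuousOn hb hθ).comp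
        differentiable_proj.differentiableOn fun p hp => hσ.trans_lt (hm.trans hp.1)
    exact h1.congr fun p hp => borelSum_eq h𝒜 hopen hρ hg hb hσ (hdir p hp)
  · rw [borelSum_eq h𝒜 hopen hρ hg hb hσ (hdir p hp)]
    refine (norm_add_le _ _).trans (add_le_add_right ?_ _)
    have hp1 : m < (proj 𝒜 σ p * Complex.exp (Complex.I * (θ : ℂ))).re := hp.1
    refine (norm_laplace_le hb hθ (by linarith)).trans ?_
    have hC : 0 ≤ C := by
      have := (norm_nonneg _).trans (hb _ (ray_mem_sector hθ zero_lt_one))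
      exact nonneg_of_mul_nonneg_left this (Real.exp_pos _)
    have : 0 < m - τ := by linarith
    gcongr

theorem differentiableOn_borelSum (h𝒜 : 𝒜.OrdConnected)
    (hopen : ∀ r : ℝ, 0 < r → IsOpen (sector 𝒜 r))
    (hρ : 0 < ρ) (hg : IsBorelExtension 𝒜 ρ φ g)
    (hb : ∀ ζ ∈ sector 𝒜 ρ, ‖g ζ‖ ≤ C * Real.exp (τ * ‖ζ‖)) (hσ : τ ≤ σ) :
    DifferentiableOn ℂ (borelSum 𝒜 σ φ) (sumDomain 𝒜 σ) := by
  intro p hp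
  obtain ⟨η, -, V, hVo, hpV, hV⟩ := exists_nhds_borelSum h𝒜 hopen hρ hσ hp
  exact ((hV φ g C hg hb).1.differentiableAt (hVo.mem_nhds hpV)).differentiableWithinAt

/-- A power series in `y` whose coefficients are holomorphic in `p` and grow at most geometrically
is holomorphic in `(p, y)`. -/
theorem differentiableAt_tsum_mul_pow {L : ℕ → ℂ → ℂ} {V : Set ℂ} {D B : ℝ} (hB : 0 < B)
    (hV : IsOpen V) (hL : ∀ k, DifferentiableOn ℂ (L k) V)
    (hbd : ∀ k, ∀ p ∈ V, ‖L k p‖ ≤ D * B ^ k) {p₀ y₀ : ℂ} (hp₀ : p₀ ∈ V) (hy₀ : ‖y₀‖ < 1 / B) :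
    DifferentiableAt ℂ (fun q : ℂ × ℂ => ∑' k, L k q.1 * q.2 ^ k) (p₀, y₀) := by
  obtain ⟨ε, hε, hball⟩ := Metric.isOpen_iff.1 hV p₀ hp₀
  obtain ⟨r, hr, hr'⟩ := exists_between hy₀
  have hr0 : 0 < r := (norm_nonneg _).trans_lt hr
  have hD : 0 ≤ D := by simpa using (norm_nonneg _).trans (hbd 0 p₀ hp₀)
  have hBr : ‖B * r‖ < 1 := by
    rw [Real.norm_eq_abs, abs_of_pos (mul_pos hB hr0)]
    rwa [lt_div_iff₀ hB, mul_comm] at hr'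
  have hu : Summable fun k : ℕ =>
      D / r * ((k : ℝ) ^ 1 * (B * r) ^ k) + D / (ε / 3) * (B * r) ^ k :=
    ((summable_pow_mul_geometric_of_norm_lt_one 1 hBr).mul_left _).add
      ((summable_geometric_of_norm_lt_one hBr).mul_left _)
  have hdisc : ∀ p ∈ Metric.ball p₀ (ε / 3), Metric.closedBall p (ε / 3) ⊆ V := by
    intro p hp w hw
    apply hball
    rw [Metric.mem_ball, Metric.mem_closedBall] at *
    linarith [dist_triangle w p p₀]
  have hmem : (p₀, y₀) ∈ Metric.ball p₀ (ε / 3) ×ˢ Metric.ball (0 : ℂ) r :=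
    ⟨Metric.mem_ball_self (by positivity), by simpa using hr⟩
  refine (hasFDerivAt_tsum_of_isPreconnected (f := fun k (q : ℂ × ℂ) => L k q.1 * q.2 ^ k)
    (f' := fun k q => (L k q.1 * (k * q.2 ^ (k - 1))) • ContinuousLinearMap.snd ℂ ℂ ℂ +
      (q.2 ^ k * deriv (L k) q.1) • ContinuousLinearMap.fst ℂ ℂ ℂ) hu
    (Metric.isOpen_ball.prod Metric.isOpen_ball)
    ((convex_ball p₀ (ε / 3)).prod (convex_ball (0 : ℂ) r)).isPreconnected ?_ ?_ hmem ?_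
    hmem).differentiableAt
  · rintro k q ⟨hq1, hq2⟩
    have h1 : HasDerivAt (L k) (deriv (L k) q.1) q.1 :=
      ((hL k).differentiableAt (hV.mem_nhds
        (hdisc _ hq1 (Metric.mem_closedBall_self (by positivity))))).hasDerivAt
    have h2 := (h1.comp_hasFDerivAt q (hasFDerivAt_fst (𝕜 := ℂ) (p := q))).mul
      ((hasDerivAt_pow k q.2).comp_hasFDerivAt q (hasFDerivAt_snd (𝕜 := ℂ) (p := q)))
    refine h2.congr_fderiv ?_
    ext <;> simp
  · rintro k q ⟨hq1, hq2⟩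
    have hq2' : ‖q.2‖ ≤ r := (mem_ball_zero_iff.1 hq2).le
    have hqV := hdisc _ hq1 (Metric.mem_closedBall_self (by positivity))
    have hder : ‖deriv (L k) q.1‖ ≤ D * B ^ k / (ε / 3) :=
      Complex.norm_deriv_le_of_forall_mem_sphere_norm_le (by positivity)
        (((hL k).mono (hdisc _ hq1)).diffContOnCl_ball subset_rfl)
        fun w hw => hbd k w (hdisc _ hq1 (Metric.sphere_subset_closedBall hw))
    have e1 : ‖L k q.1 * (k * q.2 ^ (k - 1))‖ ≤ D / r * ((k : ℝ) ^ 1 * (B * r) ^ k) := by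
      rw [norm_mul, norm_mul, norm_pow, Complex.norm_natCast]
      calc _ ≤ D * B ^ k * (k * r ^ (k - 1)) := by
            gcongr
            exact hbd k _ hqV
        _ = _ := by
            rcases k with _ | k
            · simp
            · rw [Nat.add_sub_cancel, mul_pow, pow_succ r]
              field_simp
    have e2 : ‖q.2 ^ k * deriv (L k) q.1‖ ≤ D / (ε / 3) * (B * r) ^ k := by
      rw [norm_mul, norm_pow]
      calc _ ≤ r ^ k * (D * B ^ k / (ε / 3)) := by gcongr
        _ = _ := by rw [mul_pow]; ring
    refine (norm_add_le _ _).trans (add_le_add ?_ ?_)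
    · rw [norm_smul]
      exact (mul_le_of_le_one_right (norm_nonneg _)
        (ContinuousLinearMap.norm_snd_le ..)).trans e1
    · rw [norm_smul]
      exact (mul_le_of_le_one_right (norm_nonneg _)
        (ContinuousLinearMap.norm_fst_le ..)).trans e2
  · refine Summable.of_norm_bounded ((summable_geometric_of_norm_lt_one hBr).mul_left D)
      fun k => ?_
    rw [norm_mul, norm_pow, mul_pow, ← mul_assoc]
    gcongr
    exact hbd k _ hp₀

end BorelSum

/-! ### Convolution -/

/-- The convolution `∫₀^ζ f(ξ) g(ζ - ξ) dξ` along the segment from `0` to `ζ`. -/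
def conv (f g : ℂ → ℂ) (ζ : ℂ) : ℂ :=
  ζ * ∫ s in (0 : ℝ)..1, f ((s : ℂ) * ζ) * g (((1 - s : ℝ) : ℂ) * ζ)

theorem integral_pow_mul_one_sub_pow (i j : ℕ) :
    ∫ s in (0 : ℝ)..1, (s : ℂ) ^ i * ((1 - s : ℝ) : ℂ) ^ j =
      (i.factorial * j.factorial : ℂ) / (i + j + 1).factorial := by
  have h := Complex.Gamma_mul_Gamma_eq_betaIntegral (s := i + 1) (t := j + 1)
    (by simp; positivity) (by simp; positivity)
  have e : (i + 1 + (j + 1) : ℂ) = ((i + j + 1 : ℕ) : ℂ) + 1 := by push_cast; ring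
  rw [e, Complex.Gamma_nat_eq_factorial, Complex.Gamma_nat_eq_factorial,
    Complex.Gamma_nat_eq_factorial] at h
  rw [h, mul_div_cancel_left₀ _ (Nat.cast_ne_zero.2 (Nat.factorial_ne_zero _)),
    Complex.betaIntegral]
  simp [Complex.cpow_natCast]

section Convolution

variable {𝒜 : Set ℝ} {ρ : ℝ} {f g : ℂ → ℂ}

theorem one_sub_mem_Icc {s : ℝ} (hs : s ∈ Icc (0 : ℝ) 1) : 1 - s ∈ Icc (0 : ℝ) 1 :=
  ⟨by linarith [hs.2], by linarith [hs.1]⟩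

theorem continuousOn_conv_integrand (hρ : 0 < ρ) (hf : ContinuousOn f (sector 𝒜 ρ))
    (hg : ContinuousOn g (sector 𝒜 ρ)) {ζ : ℂ} (hζ : ζ ∈ sector 𝒜 ρ) :
    ContinuousOn (fun s : ℝ => f ((s : ℂ) * ζ) * g (((1 - s : ℝ) : ℂ) * ζ)) (Icc 0 1) :=
  (hf.comp (by fun_prop) fun _ hs => smul_mem_sector hρ hζ hs).mul
    (hg.comp (by fun_prop) fun _ hs => smul_mem_sector hρ hζ (one_sub_mem_Icc hs))

theorem differentiableOn_conv (hρ : 0 < ρ) (hopen : IsOpen (sector 𝒜 ρ))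
    (hf : DifferentiableOn ℂ f (sector 𝒜 ρ)) (hg : DifferentiableOn ℂ g (sector 𝒜 ρ))
    (hfb : ∀ R : ℝ, ∃ K, ∀ ζ ∈ sector 𝒜 ρ, ‖ζ‖ ≤ R → ‖f ζ‖ ≤ K)
    (hgb : ∀ R : ℝ, ∃ K, ∀ ζ ∈ sector 𝒜 ρ, ‖ζ‖ ≤ R → ‖g ζ‖ ≤ K) :
    DifferentiableOn ℂ (conv f g) (sector 𝒜 ρ) := by
  intro ζ₀ hζ₀
  set R := ‖ζ₀‖ + 1 with hR
  obtain ⟨K, hK⟩ := hfb R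
  obtain ⟨K', hK'⟩ := hgb R
  set U := sector 𝒜 ρ ∩ Metric.ball 0 R with hU
  have hUo : IsOpen U := hopen.inter Metric.isOpen_ball
  have hζU : ζ₀ ∈ U := ⟨hζ₀, by rw [mem_ball_zero_iff]; linarith⟩
  have hnorm : ∀ ζ ∈ U, ∀ s ∈ Icc (0 : ℝ) 1, ‖(s : ℂ) * ζ‖ ≤ R := by
    intro ζ hζ s hs
    have := mem_ball_zero_iff.1 hζ.2
    rw [norm_mul, Complex.norm_real, Real.norm_eq_abs, abs_of_nonneg hs.1]
    nlinarith [hs.2, norm_nonneg ζ]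
  refine DifferentiableAt.differentiableWithinAt (differentiableAt_id.mul ?_)
  refine DifferentiableOn.differentiableAt ?_ (hUo.mem_nhds hζU)
  simp only [intervalIntegral.integral_of_le zero_le_one]
  have hIoc : ∀ {s : ℝ}, s ∈ Ioc (0 : ℝ) 1 → s ∈ Icc (0 : ℝ) 1 := fun h => Ioc_subset_Icc_self h
  refine differentiableOn_integral hUo (b := fun _ => K * K') (fun ζ hζ =>
    ((continuousOn_conv_integrand hρ hf.continuousOn hg.continuousOn hζ.1).mono
      Ioc_subset_Icc_self).aestronglyMeasurable measurableSet_Ioc) ?_ ?_ (integrable_const _)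
  · filter_upwards [self_mem_ae_restrict measurableSet_Ioc] with s hs
    exact (hf.comp (by fun_prop) fun ζ hζ => smul_mem_sector hρ hζ.1 (hIoc hs)).mul
      (hg.comp (by fun_prop) fun ζ hζ => smul_mem_sector hρ hζ.1 (one_sub_mem_Icc (hIoc hs)))
  · filter_upwards [self_mem_ae_restrict measurableSet_Ioc] with s hs ζ hζ
    rw [norm_mul]
    have h1 := hK _ (smul_mem_sector hρ hζ.1 (hIoc hs)) (hnorm ζ hζ s (hIoc hs))
    have h2 := hK' _ (smul_mem_sector hρ hζ.1 (one_sub_mem_Icc (hIoc hs)))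
      (hnorm ζ hζ _ (one_sub_mem_Icc (hIoc hs)))
    exact mul_le_mul h1 h2 (norm_nonneg _) ((norm_nonneg _).trans h1)

/-- The Taylor series of a convolution, from `∫₀¹ sⁱ (1 - s)ʲ ds = i! j! / (i + j + 1)!`. -/
theorem hasSum_conv {a b α β : ℕ → ℂ} (hα : ∀ n, α n = a n / (n.factorial : ℂ))
    (hβ : ∀ n, β n = b n / (n.factorial : ℂ))
    (hf : ∀ ζ ∈ Metric.ball (0 : ℂ) ρ, HasSum (fun n => α n * ζ ^ n) (f ζ))
    (hg : ∀ ζ ∈ Metric.ball (0 : ℂ) ρ, HasSum (fun n => β n * ζ ^ n) (g ζ))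
    {ζ : ℂ} (hζ : ζ ∈ Metric.ball (0 : ℂ) ρ) :
    HasSum (fun n => (∑ x ∈ Finset.HasAntidiagonal.antidiagonal n, a x.1 * b x.2) /
      ((n + 1).factorial : ℂ) * ζ ^ (n + 1)) (conv f g ζ) := by
  have hsm : ∀ {s : ℝ}, s ∈ Icc (0 : ℝ) 1 → (s : ℂ) * ζ ∈ Metric.ball (0 : ℂ) ρ := by
    intro s hs
    rw [mem_ball_zero_iff] at *
    rw [norm_mul, Complex.norm_real, Real.norm_eq_abs, abs_of_nonneg hs.1]
    nlinarith [hs.2, norm_nonneg ζ]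
  have hprod : Summable fun x : ℕ × ℕ => ‖α x.1 * ζ ^ x.1‖ * ‖β x.2 * ζ ^ x.2‖ :=
    (hf ζ hζ).summable.norm.mul_of_nonneg (hg ζ hζ).summable.norm
      (fun _ => norm_nonneg _) (fun _ => norm_nonneg _)
  obtain ⟨T, hTdef⟩ : ∃ T : ℕ × ℕ → ℝ → ℂ, ∀ x s, T x s =
      α x.1 * ((s : ℂ) * ζ) ^ x.1 * (β x.2 * (((1 - s : ℝ) : ℂ) * ζ) ^ x.2) :=
    ⟨_, fun _ _ => rfl⟩
  have hT : ∀ x, Continuous (T x) := fun x => by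
    rw [funext (hTdef x)]
    fun_prop
  have hTn : ∀ x, ∀ s ∈ Icc (0 : ℝ) 1, ‖T x s‖ ≤ ‖α x.1 * ζ ^ x.1‖ * ‖β x.2 * ζ ^ x.2‖ := by
    intro x s hs
    have h1 : |s| ^ x.1 ≤ 1 := pow_le_one₀ (abs_nonneg _) (by rw [abs_of_nonneg hs.1]; exact hs.2)
    have h2 : |1 - s| ^ x.2 ≤ 1 := by
      have := one_sub_mem_Icc hs
      exact pow_le_one₀ (abs_nonneg _) (by rw [abs_of_nonneg this.1]; exact this.2)
    simp only [hTdef, norm_mul, norm_pow, mul_pow, Complex.norm_real, Real.norm_eq_abs]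
    calc _ = (‖α x.1‖ * ‖ζ‖ ^ x.1) * (‖β x.2‖ * ‖ζ‖ ^ x.2) * (|s| ^ x.1 * |1 - s| ^ x.2) := by ring
      _ ≤ (‖α x.1‖ * ‖ζ‖ ^ x.1) * (‖β x.2‖ * ‖ζ‖ ^ x.2) * (1 * 1) := by gcongr
      _ = _ := by ring
  have hint : ∀ x, IntegrableOn (T x) (Ioc 0 1) := fun x =>
    ((hT x).integrableOn_Icc (a := 0) (b := 1)).mono_set Ioc_subset_Icc_self
  have hsum := hasSum_integral_of_summable_integral_norm hint (by
    refine Summable.of_nonneg_of_le (fun _ => integral_nonneg fun _ => norm_nonneg _)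
      (fun x => ?_) hprod
    have := setIntegral_mono_on (hint x).norm (integrableOn_const (by simp)) measurableSet_Ioc
      fun s hs => hTn x s (Ioc_subset_Icc_self hs)
    simpa using this)
  have hpt : ∀ s ∈ Ioc (0 : ℝ) 1,
      ∑' x, T x s = f ((s : ℂ) * ζ) * g (((1 - s : ℝ) : ℂ) * ζ) := by
    intro s hs
    have h1 := hf _ (hsm (Ioc_subset_Icc_self hs))
    have h2 := hg _ (hsm (one_sub_mem_Icc (Ioc_subset_Icc_self hs)))
    have hs' := summable_mul_of_summable_norm (f := fun n => α n * ((s : ℂ) * ζ) ^ n)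
      (g := fun n => β n * (((1 - s : ℝ) : ℂ) * ζ) ^ n) h1.summable.norm h2.summable.norm
    rw [← (h1.mul h2 hs').tsum_eq]
    exact tsum_congr fun x => hTdef x s
  have hval : ∫ s in Ioc (0 : ℝ) 1, ∑' x, T x s =
      ∫ s in (0 : ℝ)..1, f ((s : ℂ) * ζ) * g (((1 - s : ℝ) : ℂ) * ζ) := by
    rw [intervalIntegral.integral_of_le zero_le_one]
    exact setIntegral_congr_fun measurableSet_Ioc hpt
  have hterm : ∀ x : ℕ × ℕ, ζ * ∫ s in Ioc (0 : ℝ) 1, T x s =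
      a x.1 * b x.2 / ((x.1 + x.2 + 1).factorial : ℂ) * ζ ^ (x.1 + x.2 + 1) := by
    intro x
    have e : ∀ s : ℝ, T x s = α x.1 * β x.2 * ζ ^ (x.1 + x.2) *
        ((s : ℂ) ^ x.1 * ((1 - s : ℝ) : ℂ) ^ x.2) := by
      intro s
      simp only [hTdef, mul_pow, pow_add]
      ring
    have h1 : (x.1.factorial : ℂ) ≠ 0 := Nat.cast_ne_zero.2 (Nat.factorial_ne_zero _)
    have h2 : (x.2.factorial : ℂ) ≠ 0 := Nat.cast_ne_zero.2 (Nat.factorial_ne_zero _)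
    have h3 : ((x.1 + x.2 + 1).factorial : ℂ) ≠ 0 := Nat.cast_ne_zero.2 (Nat.factorial_ne_zero _)
    rw [← intervalIntegral.integral_of_le zero_le_one]
    simp only [e]
    rw [intervalIntegral.integral_const_mul, integral_pow_mul_one_sub_pow, hα, hβ]
    field_simp
    ring
  rw [hval] at hsum
  have hsum' := hsum.mul_left ζ
  simp only [hterm] at hsum'
  rw [← Finset.HasAntidiagonal.sigmaAntidiagonalEquivProd.hasSum_iff] at hsum'
  refine (hsum'.sigma fun n => hasSum_fintype _).congr_fun fun n => ?_
  simp only [Function.comp_def, Finset.HasAntidiagonal.sigmaAntidiagonalEquivProd_apply]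
  rw [Finset.univ_eq_attach, Finset.sum_attach _ (fun x : ℕ × ℕ =>
    a x.1 * b x.2 / ((x.1 + x.2 + 1).factorial : ℂ) * ζ ^ (x.1 + x.2 + 1)), Finset.sum_div,
    Finset.sum_mul]
  refine Finset.sum_congr rfl fun x hx => ?_
  rw [Finset.HasAntidiagonal.mem_antidiagonal.1 hx]

theorem coeff_succ_mul (φ ψ : ℂ⟦X⟧) (n : ℕ) :
    PowerSeries.coeff (n + 2) (φ * ψ) =
      PowerSeries.constantCoeff φ * PowerSeries.coeff (n + 2) ψ +
      PowerSeries.constantCoeff ψ * PowerSeries.coeff (n + 2) φ +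
      ∑ x ∈ Finset.HasAntidiagonal.antidiagonal n,
        PowerSeries.coeff (x.1 + 1) φ * PowerSeries.coeff (x.2 + 1) ψ := by
  rw [PowerSeries.coeff_mul, Finset.Nat.antidiagonal_succ_succ', Finset.sum_cons, Finset.sum_cons,
    Finset.sum_map]
  simp
  ring

/-- The Borel transform turns the product of series into the convolution of functions (plus the
contribution of the constant terms). -/
theorem IsBorelExtension.mul (hρ : 0 < ρ) (hopen : IsOpen (sector 𝒜 ρ)) {φ ψ : ℂ⟦X⟧}
    (hf : IsBorelExtension 𝒜 ρ φ f) (hg : IsBorelExtension 𝒜 ρ ψ g)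
    (hfb : ∀ R : ℝ, ∃ K, ∀ ζ ∈ sector 𝒜 ρ, ‖ζ‖ ≤ R → ‖f ζ‖ ≤ K)
    (hgb : ∀ R : ℝ, ∃ K, ∀ ζ ∈ sector 𝒜 ρ, ‖ζ‖ ≤ R → ‖g ζ‖ ≤ K) :
    IsBorelExtension 𝒜 ρ (φ * ψ) fun ζ => PowerSeries.constantCoeff φ * g ζ +
      PowerSeries.constantCoeff ψ * f ζ + conv f g ζ := by
  refine ⟨((hg.1.const_mul _).add (hf.1.const_mul _)).add
    (differentiableOn_conv hρ hopen hf.1 hg.1 hfb hgb), fun ζ hζ => ?_⟩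
  have h0 : PowerSeries.coeff 1 (φ * ψ) = PowerSeries.constantCoeff φ * PowerSeries.coeff 1 ψ +
      PowerSeries.constantCoeff ψ * PowerSeries.coeff 1 φ := by
    rw [PowerSeries.coeff_mul]
    simp [Finset.Nat.antidiagonal_succ]
    ring
  have hB : ∀ (χ : ℂ⟦X⟧) (n : ℕ), PowerSeries.coeff n (borelTransform χ) =
      PowerSeries.coeff (n + 1) χ / (n.factorial : ℂ) := fun χ n => PowerSeries.coeff_mk _ _
  obtain ⟨G, hG⟩ : ∃ G : ℕ → ℂ, ∀ n, G n =
      PowerSeries.constantCoeff φ * (PowerSeries.coeff n (borelTransform ψ) * ζ ^ n) +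
      PowerSeries.constantCoeff ψ * (PowerSeries.coeff n (borelTransform φ) * ζ ^ n) :=
    ⟨_, fun _ => rfl⟩
  have h1 : HasSum G (PowerSeries.constantCoeff φ * g ζ + PowerSeries.constantCoeff ψ * f ζ) := by
    rw [funext hG]
    exact ((hg.2 ζ hζ).mul_left _).add ((hf.2 ζ hζ).mul_left _)
  have h2 := ((hasSum_nat_add_iff' 1).2 h1).add (hasSum_conv (hB φ) (hB ψ) hf.2 hg.2 hζ)
  rw [← hasSum_nat_add_iff' 1]
  convert h2 using 1
  · funext n
    rw [hB, hG, hB, hB, coeff_succ_mul]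
    ring
  · simp only [Finset.sum_range_one, hG, hB, zero_add, h0, Nat.factorial_zero, pow_zero]
    ring

/-- The Laplace transform turns convolution into multiplication. -/
theorem laplace_conv {θ : ℝ} {z : ℂ} (hf : IntegrableOn (laplaceIntegrand f θ z) (Ioi 0))
    (hg : IntegrableOn (laplaceIntegrand g θ z) (Ioi 0)) :
    laplace (conv f g) θ z = laplace f θ z * laplace g θ z := by
  have h := integral_posConvolution hf hg (ContinuousLinearMap.mul ℝ ℂ)
  simp only [ContinuousLinearMap.mul_apply'] at h
  rw [laplace, laplace, laplace, ← h]
  refine setIntegral_congr_fun measurableSet_Ioi fun t ht => ?_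
  set u := Complex.exp (Complex.I * (θ : ℂ)) with hu
  have e : ∀ s : ℝ, laplaceIntegrand f θ z s * laplaceIntegrand g θ z (t - s) =
      (f ((s : ℂ) * u) * g (((t - s : ℝ) : ℂ) * u)) *
        (Complex.exp (-(z * ((t : ℂ) * u))) * u ^ 2) := by
    intro s
    have : Complex.exp (-(z * ((t : ℂ) * u))) = Complex.exp (-(z * ((s : ℂ) * u))) *
        Complex.exp (-(z * (((t - s : ℝ) : ℂ) * u))) := by
      rw [← Complex.exp_add]; congr 1; push_cast; ring
    rw [this]
    simp only [laplaceIntegrand, ← hu]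
    ring
  have h2 := intervalIntegral.smul_integral_comp_mul_left (a := 0) (b := 1)
    (fun s : ℝ => f ((s : ℂ) * u) * g (((t - s : ℝ) : ℂ) * u)) t
  rw [mul_zero, mul_one] at h2
  simp only [e]
  rw [intervalIntegral.integral_mul_const, ← h2, laplaceIntegrand, conv, Complex.real_smul]
  have e2 : ∀ s : ℝ, f ((s : ℂ) * ((t : ℂ) * u)) * g (((1 - s : ℝ) : ℂ) * ((t : ℂ) * u)) =
      f (((t * s : ℝ) : ℂ) * u) * g (((t - t * s : ℝ) : ℂ) * u) := by
    intro s
    push_cast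
    congr 2 <;> ring
  simp only [← hu, e2]
  ring

end Convolution

/-! ### A weight which is submultiplicative for convolution -/

/-- The weight `(M / 8) e^(νr) / (1 + M² r²)`. The factor `1 / (1 + M² r²)` makes the convolution
square of the weight at most the weight (the normalization by `8` absorbs the `2π` coming from the
integral of `1 / (1 + s²)`), and a large `M` makes the weight large. -/
def weight (M ν r : ℝ) : ℝ := M / 8 * Real.exp (ν * r) / (1 + (M * r) ^ 2)

section Weight

variable {M ν r : ℝ}

theorem weight_pos (hM : 0 < M) (ν r : ℝ) : 0 < weight M ν r := by
  unfold weight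
  positivity

theorem weight_le (hM : 0 < M) (ν r : ℝ) : weight M ν r ≤ M / 8 * Real.exp (ν * r) :=
  div_le_self (by positivity) (by nlinarith [sq_nonneg (M * r)])

theorem continuous_weight : Continuous (weight M ν) := by
  unfold weight
  refine Continuous.div (by fun_prop) (by fun_prop) fun r => ?_
  positivity

/-- Any multiple of any exponential is below a weight, even at `r = 0`, where only `M` matters. -/
theorem mul_exp_le_weight {N τ : ℝ} (hN : 0 < N) (hr : 0 ≤ r) :
    N * Real.exp (τ * r) ≤ weight (8 * N) (τ + 2 * (8 * N)) r := by
  unfold weight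
  rw [le_div_iff₀ (by positivity), add_mul, Real.exp_add]
  have h := Real.quadratic_le_exp_of_nonneg (show 0 ≤ 2 * (8 * N) * r by positivity)
  have h1 : 1 + (8 * N * r) ^ 2 ≤ Real.exp (2 * (8 * N) * r) := by
    have : 0 ≤ N * r := by positivity
    nlinarith
  calc _ ≤ N * Real.exp (τ * r) * Real.exp (2 * (8 * N) * r) := by gcongr
    _ = _ := by ring

theorem integral_inv_one_add_mul_sq_le (a : ℝ) :
    a * ∫ s in (0 : ℝ)..1, (1 + (a * s) ^ 2)⁻¹ ≤ 2 := by
  have h := intervalIntegral.smul_integral_comp_mul_left (a := 0) (b := 1)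
    (fun s : ℝ => (1 + s ^ 2)⁻¹) a
  rw [smul_eq_mul] at h
  rw [h, mul_zero, mul_one, integral_inv_one_add_sq, Real.arctan_zero, sub_zero]
  linarith [Real.arctan_lt_pi_div_two a, Real.pi_lt_four]

/-- The convolution square of the weight is at most the weight. -/
theorem integral_weight_mul_weight_le (hM : 0 < M) (hr : 0 ≤ r) :
    r * ∫ s in (0 : ℝ)..1, weight M ν (s * r) * weight M ν ((1 - s) * r) ≤ weight M ν r := by
  rcases hr.eq_or_lt with rfl | hr
  · rw [zero_mul]
    exact (weight_pos hM _ _).le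
  set a := M * r with ha
  have ha0 : 0 < a := mul_pos hM hr
  set K := (M / 8) ^ 2 * Real.exp (ν * r) * (2 / (1 + a ^ 2)) with hK
  have hcont : Continuous fun s : ℝ => (1 + (a * s) ^ 2)⁻¹ :=
    Continuous.inv₀ (by fun_prop) fun s => by positivity
  have hcont' : Continuous fun s : ℝ => (1 + (a * (1 - s)) ^ 2)⁻¹ :=
    Continuous.inv₀ (by fun_prop) fun s => by positivity
  have hpt : ∀ s : ℝ, weight M ν (s * r) * weight M ν ((1 - s) * r) ≤
      K * ((1 + (a * s) ^ 2)⁻¹ + (1 + (a * (1 - s)) ^ 2)⁻¹) := by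
    intro s
    have e1 : Real.exp (ν * r) = Real.exp (ν * (s * r)) * Real.exp (ν * ((1 - s) * r)) := by
      rw [← Real.exp_add]; ring_nf
    have e2 : M * (s * r) = a * s := by rw [ha]; ring
    have e3 : M * ((1 - s) * r) = a * (1 - s) := by rw [ha]; ring
    have e4 : weight M ν (s * r) * weight M ν ((1 - s) * r) = (M / 8) ^ 2 * Real.exp (ν * r) *
        ((1 + (a * s) ^ 2)⁻¹ * (1 + (a * (1 - s)) ^ 2)⁻¹) := by
      rw [weight, weight, e1, e2, e3]
      field_simp
    rw [e4, hK, mul_assoc _ (2 / (1 + a ^ 2))]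
    refine mul_le_mul_of_nonneg_left ?_ (by positivity)
    have h1 : 1 + a ^ 2 ≤ 2 * ((1 + (a * s) ^ 2) + (1 + (a * (1 - s)) ^ 2)) := by
      nlinarith [sq_nonneg (a * s - a * (1 - s))]
    have hx : 0 < 1 + (a * s) ^ 2 := by positivity
    have hy : 0 < 1 + (a * (1 - s)) ^ 2 := by positivity
    have hz : 0 < 1 + a ^ 2 := by positivity
    generalize 1 + (a * s) ^ 2 = x at *
    generalize 1 + (a * (1 - s)) ^ 2 = y at *
    generalize 1 + a ^ 2 = z at *
    rw [← sub_nonneg]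
    have : 2 / z * (x⁻¹ + y⁻¹) - x⁻¹ * y⁻¹ = (2 * (x + y) - z) / (z * x * y) := by
      field_simp
      ring
    rw [this]
    exact div_nonneg (by linarith) (by positivity)
  have hint : ∫ s in (0 : ℝ)..1, weight M ν (s * r) * weight M ν ((1 - s) * r) ≤
      K * (2 * ∫ s in (0 : ℝ)..1, (1 + (a * s) ^ 2)⁻¹) := by
    have hsymm : ∫ s in (0 : ℝ)..1, (1 + (a * (1 - s)) ^ 2)⁻¹ =
        ∫ s in (0 : ℝ)..1, (1 + (a * s) ^ 2)⁻¹ := by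
      have := intervalIntegral.integral_comp_sub_left (a := 0) (b := 1)
        (fun s : ℝ => (1 + (a * s) ^ 2)⁻¹) 1
      simpa using this
    refine (intervalIntegral.integral_mono_on zero_le_one
      (Continuous.intervalIntegrable ?_ _ _) (Continuous.intervalIntegrable ?_ _ _)
      fun s _ => hpt s).trans_eq ?_
    · exact (continuous_weight.comp (by fun_prop)).mul (continuous_weight.comp (by fun_prop))
    · exact continuous_const.mul (hcont.add hcont')
    · rw [intervalIntegral.integral_const_mul, intervalIntegral.integral_add
        (hcont.intervalIntegrable _ _) (hcont'.intervalIntegrable _ _), hsymm, two_mul]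
  have hI := integral_inv_one_add_mul_sq_le a
  set I := ∫ s in (0 : ℝ)..1, (1 + (a * s) ^ 2)⁻¹
  calc _ ≤ r * (K * (2 * I)) := by gcongr
    _ = M * Real.exp (ν * r) / (16 * (1 + a ^ 2)) * (a * I) := by
      rw [hK, ha]; field_simp; ring
    _ ≤ M * Real.exp (ν * r) / (16 * (1 + a ^ 2)) * 2 := by gcongr
    _ = _ := by rw [weight, ← ha]; field_simp; ring

theorem integrableOn_weight_mul_exp (hM : 0 < M) {x : ℝ} (hx : ν ≤ x) :
    IntegrableOn (fun t => weight M ν t * Real.exp (-x * t)) (Ioi 0) ∧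
      ∫ t in Ioi (0 : ℝ), weight M ν t * Real.exp (-x * t) ≤ 1 := by
  have hint : Integrable fun t : ℝ => M / 8 * (1 + (M * t) ^ 2)⁻¹ :=
    (integrable_inv_one_add_sq.comp_mul_left' hM.ne').const_mul _
  have hle : ∀ t ∈ Ioi (0 : ℝ), weight M ν t * Real.exp (-x * t) ≤
      M / 8 * (1 + (M * t) ^ 2)⁻¹ := by
    intro t ht
    have ht' : (0 : ℝ) < t := ht
    have h1 : Real.exp (ν * t) * Real.exp (-x * t) ≤ 1 := by
      rw [← Real.exp_add, Real.exp_le_one_iff]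
      nlinarith
    calc _ = M / 8 * (1 + (M * t) ^ 2)⁻¹ * (Real.exp (ν * t) * Real.exp (-x * t)) := by
          rw [weight]; field_simp
      _ ≤ _ := mul_le_of_le_one_right (by positivity) h1
  have hint' : IntegrableOn (fun t => weight M ν t * Real.exp (-x * t)) (Ioi 0) := by
    refine hint.integrableOn.mono' (continuous_weight.mul (by fun_prop)).aestronglyMeasurable ?_
    filter_upwards [self_mem_ae_restrict measurableSet_Ioi] with t ht
    rw [Real.norm_of_nonneg (mul_nonneg (weight_pos hM _ _).le (Real.exp_pos _).le)]
    exact hle t ht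
  refine ⟨hint', ?_⟩
  calc _ ≤ ∫ t in Ioi (0 : ℝ), M / 8 * (1 + (M * t) ^ 2)⁻¹ :=
        setIntegral_mono_on hint' hint.integrableOn measurableSet_Ioi hle
    _ = M / 8 * (M⁻¹ * (Real.pi / 2)) := by
        rw [integral_const_mul, integral_comp_mul_left_Ioi (fun t => (1 + t ^ 2)⁻¹) 0 hM, mul_zero,
          integral_Ioi_inv_one_add_sq, Real.arctan_zero, sub_zero, smul_eq_mul]
    _ ≤ 1 := by
        field_simp
        linarith [Real.pi_lt_four]

end Weight

/-! ### The Banach algebra of Borel transformable series -/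

/-- A sector `S(ρ, 𝒜)` together with the parameters of the weight bounding the functions on it. -/
structure WeightedSector where
  /-- the directions -/
  𝒜 : Set ℝ
  /-- the radius of the disc -/
  ρ : ℝ
  /-- the size of the weight -/
  M : ℝ
  /-- the exponential type of the weight -/
  ν : ℝ
  hρ : 0 < ρ
  hM : 0 < M
  hopen : ∀ r : ℝ, 0 < r → IsOpen (sector 𝒜 r)

namespace WeightedSector

variable (P : WeightedSector)

/-- The sector. -/
abbrev S : Set ℂ := sector P.𝒜 P.ρ

/-- The weight at a point of the plane. -/
abbrev W (ζ : ℂ) : ℝ := weight P.M P.ν ‖ζ‖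

theorem W_pos (ζ : ℂ) : 0 < P.W ζ := weight_pos P.hM _ _

theorem isOpen_S : IsOpen P.S := P.hopen _ P.hρ

variable {P}

theorem exists_bound_of_le_weight {g : ℂ → ℂ} {C : ℝ} (hg : ∀ ζ ∈ P.S, ‖g ζ‖ ≤ C * P.W ζ) (R : ℝ) :
    ∃ K, ∀ ζ ∈ P.S, ‖ζ‖ ≤ R → ‖g ζ‖ ≤ K := by
  refine ⟨|C| * (P.M / 8 * Real.exp (|P.ν| * R)), fun ζ hζ hR => (hg ζ hζ).trans ?_⟩
  have hM := P.hM
  have h1 : P.ν * ‖ζ‖ ≤ |P.ν| * R :=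
    mul_le_mul (le_abs_self _) hR (norm_nonneg _) (abs_nonneg _)
  refine mul_le_mul (le_abs_self C) ?_ (P.W_pos ζ).le (abs_nonneg _)
  refine (weight_le P.hM _ _).trans ?_
  gcongr

theorem norm_conv_le {f g : ℂ → ℂ} {C D : ℝ} (hf : ∀ ζ ∈ P.S, ‖f ζ‖ ≤ C * P.W ζ)
    (hg : ∀ ζ ∈ P.S, ‖g ζ‖ ≤ D * P.W ζ) {ζ : ℂ} (hζ : ζ ∈ P.S) :
    ‖conv f g ζ‖ ≤ C * D * P.W ζ := by
  have hCD : 0 ≤ C ∧ 0 ≤ D :=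
    ⟨nonneg_of_mul_nonneg_left ((norm_nonneg _).trans (hf ζ hζ)) (P.W_pos ζ),
      nonneg_of_mul_nonneg_left ((norm_nonneg _).trans (hg ζ hζ)) (P.W_pos ζ)⟩
  have hn : ∀ s ∈ Icc (0 : ℝ) 1, P.W ((s : ℂ) * ζ) = weight P.M P.ν (s * ‖ζ‖) := by
    intro s hs
    simp only [W, norm_mul, Complex.norm_real, Real.norm_eq_abs, abs_of_nonneg hs.1]
  have hpt : ∀ s ∈ Icc (0 : ℝ) 1, ‖f ((s : ℂ) * ζ) * g (((1 - s : ℝ) : ℂ) * ζ)‖ ≤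
      C * D * (weight P.M P.ν (s * ‖ζ‖) * weight P.M P.ν ((1 - s) * ‖ζ‖)) := by
    intro s hs
    have h1 := hf _ (smul_mem_sector P.hρ hζ hs)
    have h2 := hg _ (smul_mem_sector P.hρ hζ (one_sub_mem_Icc hs))
    rw [hn s hs] at h1
    rw [hn _ (one_sub_mem_Icc hs)] at h2
    rw [norm_mul]
    calc _ ≤ (C * weight P.M P.ν (s * ‖ζ‖)) * (D * weight P.M P.ν ((1 - s) * ‖ζ‖)) :=
          mul_le_mul h1 h2 (norm_nonneg _) ((norm_nonneg _).trans h1)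
      _ = _ := by ring
  have h := intervalIntegral.norm_integral_le_of_norm_le (μ := volume) zero_le_one
    (Eventually.of_forall fun s (hs : s ∈ Ioc (0 : ℝ) 1) => hpt s (Ioc_subset_Icc_self hs))
    (Continuous.intervalIntegrable (continuous_const.mul
      ((continuous_weight.comp (by fun_prop)).mul (continuous_weight.comp (by fun_prop)))) _ _)
  rw [intervalIntegral.integral_const_mul] at h
  rw [conv, norm_mul]
  calc _ ≤ ‖ζ‖ * (C * D * ∫ s in (0 : ℝ)..1,
        weight P.M P.ν (s * ‖ζ‖) * weight P.M P.ν ((1 - s) * ‖ζ‖)) := by gcongr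
    _ = C * D * (‖ζ‖ * ∫ s in (0 : ℝ)..1,
        weight P.M P.ν (s * ‖ζ‖) * weight P.M P.ν ((1 - s) * ‖ζ‖)) := by ring
    _ ≤ _ := mul_le_mul_of_nonneg_left (integral_weight_mul_weight_le P.hM (norm_nonneg ζ))
        (mul_nonneg hCD.1 hCD.2)

variable (P)

/-- `g` extends the Borel transform of `φ` to the sector and is at most `C` times the weight. -/
def Bounded (φ : ℂ⟦X⟧) (g : ℂ → ℂ) (C : ℝ) : Prop :=
  IsBorelExtension P.𝒜 P.ρ φ g ∧ ∀ ζ ∈ P.S, ‖g ζ‖ ≤ C * P.W ζ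

variable {P}

namespace Bounded

variable {φ ψ : ℂ⟦X⟧} {f g : ℂ → ℂ} {C D : ℝ}

theorem nonneg (hf : P.Bounded φ f C) : 0 ≤ C :=
  nonneg_of_mul_nonneg_left ((norm_nonneg _).trans (hf.2 0 (zero_mem_sector P.hρ))) (P.W_pos 0)

theorem add (hf : P.Bounded φ f C) (hg : P.Bounded ψ g D) :
    P.Bounded (φ + ψ) (fun ζ => f ζ + g ζ) (C + D) := by
  refine ⟨⟨hf.1.1.add hg.1.1, fun ζ hζ => ?_⟩, fun ζ hζ => ?_⟩
  · refine ((hf.1.2 ζ hζ).add (hg.1.2 ζ hζ)).congr_fun fun n => ?_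
    simp only [borelTransform, PowerSeries.coeff_mk, map_add]
    ring
  · rw [add_mul]
    exact (norm_add_le _ _).trans (add_le_add (hf.2 ζ hζ) (hg.2 ζ hζ))

theorem smul (c : ℂ) (hf : P.Bounded φ f C) :
    P.Bounded (c • φ) (fun ζ => c * f ζ) (‖c‖ * C) := by
  refine ⟨⟨hf.1.1.const_mul _, fun ζ hζ => ?_⟩, fun ζ hζ => ?_⟩
  · refine ((hf.1.2 ζ hζ).mul_left c).congr_fun fun n => ?_
    simp only [borelTransform, PowerSeries.coeff_mk, map_smul, smul_eq_mul]
    ring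
  · rw [norm_mul, mul_assoc]
    exact mul_le_mul_of_nonneg_left (hf.2 ζ hζ) (norm_nonneg _)

theorem const (c : ℂ) : P.Bounded (algebraMap ℂ ℂ⟦X⟧ c) (fun _ => 0) 0 := by
  refine ⟨⟨differentiableOn_const _, fun ζ _ => ?_⟩, fun ζ _ => by simp⟩
  refine hasSum_zero.congr_fun fun n => ?_
  simp [borelTransform]

theorem mul (hf : P.Bounded φ f C) (hg : P.Bounded ψ g D) :
    P.Bounded (φ * ψ) (fun ζ => PowerSeries.constantCoeff φ * g ζ +
      PowerSeries.constantCoeff ψ * f ζ + conv f g ζ)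
      (‖PowerSeries.constantCoeff φ‖ * D + ‖PowerSeries.constantCoeff ψ‖ * C + C * D) := by
  refine ⟨hf.1.mul P.hρ P.isOpen_S hg.1 (exists_bound_of_le_weight hf.2)
    (exists_bound_of_le_weight hg.2), fun ζ hζ => ?_⟩
  rw [add_mul, add_mul, mul_assoc, mul_assoc]
  refine (norm_add₃_le ..).trans ?_
  rw [norm_mul, norm_mul]
  gcongr
  · exact hg.2 ζ hζ
  · exact hf.2 ζ hζ
  · exact norm_conv_le hf.2 hg.2 hζ

end Bounded

variable (P)

/-- The series whose Borel transform extends to the sector and is bounded by a multiple of the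
weight. -/
def subalgebra : Subalgebra ℂ ℂ⟦X⟧ where
  carrier := {φ | ∃ g C, P.Bounded φ g C}
  mul_mem' := fun ⟨_, _, hf⟩ ⟨_, _, hg⟩ => ⟨_, _, hf.mul hg⟩
  add_mem' := fun ⟨_, _, hf⟩ ⟨_, _, hg⟩ => ⟨_, _, hf.add hg⟩
  algebraMap_mem' := fun c => ⟨_, _, Bounded.const c⟩

/-- The algebra of the series whose Borel transform extends to the sector and is bounded by a
multiple of the weight, for the product of series; it is normed by the absolute value of the
constant term plus the best constant in the bound. -/
def Alg : Type := P.subalgebra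

instance : CommRing P.Alg := inferInstanceAs (CommRing P.subalgebra)

instance : Algebra ℂ P.Alg := inferInstanceAs (Algebra ℂ P.subalgebra)

/-- The inclusion of the algebra in the formal series. -/
def toSeries : P.Alg →ₐ[ℂ] ℂ⟦X⟧ := P.subalgebra.val

theorem toSeries_injective : Function.Injective P.toSeries := Subtype.val_injective

/-- The element of the algebra given by a series with a bounded Borel transform. -/
def ofBounded {φ : ℂ⟦X⟧} {g : ℂ → ℂ} {C : ℝ} (h : P.Bounded φ g C) : P.Alg := ⟨φ, g, C, h⟩

variable {P}

@[simp]
theorem toSeries_ofBounded {φ : ℂ⟦X⟧} {g : ℂ → ℂ} {C : ℝ} (h : P.Bounded φ g C) :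
    P.toSeries (P.ofBounded h) = φ := rfl

/-- The constant term. -/
def cst (x : P.Alg) : ℂ := PowerSeries.constantCoeff (P.toSeries x)

/-- The Borel transform on the sector (an arbitrary choice is made outside). -/
def ext (x : P.Alg) : ℂ → ℂ := Classical.choose x.2

/-- The best constant in the bound of the Borel transform by the weight. -/
def supNorm (x : P.Alg) : ℝ := sSup ((fun ζ => ‖ext x ζ‖ / P.W ζ) '' P.S)

theorem bounded_ext (x : P.Alg) : P.Bounded (P.toSeries x) (ext x) (supNorm x) := by
  obtain ⟨C, hC⟩ := Classical.choose_spec x.2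
  refine ⟨hC.1, fun ζ hζ => ?_⟩
  rw [← div_le_iff₀ (P.W_pos ζ)]
  refine le_csSup ⟨C, ?_⟩ ⟨ζ, hζ, rfl⟩
  rintro _ ⟨ζ, hζ, rfl⟩
  exact (div_le_iff₀ (P.W_pos ζ)).2 (hC.2 ζ hζ)

theorem supNorm_nonneg (x : P.Alg) : 0 ≤ supNorm x := (bounded_ext x).nonneg

theorem eqOn_ext (x : P.Alg) {g : ℂ → ℂ} (h : IsBorelExtension P.𝒜 P.ρ (P.toSeries x) g) :
    EqOn (ext x) g P.S := by
  have := (bounded_ext x).1.eqOn P.hopen P.hρ P.hρ h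
  rwa [min_self] at this

theorem supNorm_le (x : P.Alg) {g : ℂ → ℂ} {C : ℝ} (h : P.Bounded (P.toSeries x) g C) :
    supNorm x ≤ C := by
  refine csSup_le ((nonempty_of_mem (zero_mem_sector P.hρ)).image _) ?_
  rintro _ ⟨ζ, hζ, rfl⟩
  rw [div_le_iff₀ (P.W_pos ζ), eqOn_ext x h.1 hζ]
  exact h.2 ζ hζ

instance : Norm P.Alg := ⟨fun x => ‖cst x‖ + supNorm x⟩

theorem norm_def (x : P.Alg) : ‖x‖ = ‖cst x‖ + supNorm x := rfl

theorem norm_cst_le (x : P.Alg) : ‖cst x‖ ≤ ‖x‖ := by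
  rw [norm_def]
  linarith [supNorm_nonneg x]

theorem supNorm_le_norm (x : P.Alg) : supNorm x ≤ ‖x‖ := by
  rw [norm_def]
  linarith [norm_nonneg (cst x)]

theorem norm_add_le_add (x y : P.Alg) : ‖x + y‖ ≤ ‖x‖ + ‖y‖ := by
  have h : supNorm (x + y) ≤ supNorm x + supNorm y :=
    supNorm_le _ (by rw [map_add]; exact (bounded_ext x).add (bounded_ext y))
  have h2 : ‖cst (x + y)‖ ≤ ‖cst x‖ + ‖cst y‖ := by
    simp only [cst, map_add]
    exact norm_add_le _ _
  simp only [norm_def]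
  linarith

theorem norm_smul_le_mul (c : ℂ) (x : P.Alg) : ‖c • x‖ ≤ ‖c‖ * ‖x‖ := by
  have h : supNorm (c • x) ≤ ‖c‖ * supNorm x :=
    supNorm_le _ (by rw [map_smul]; exact (bounded_ext x).smul c)
  have h2 : ‖cst (c • x)‖ = ‖c‖ * ‖cst x‖ := by
    simp [cst]
  simp only [norm_def]
  linarith

theorem norm_algebraMap_eq (c : ℂ) : ‖algebraMap ℂ P.Alg c‖ = ‖c‖ := by
  have h : supNorm (algebraMap ℂ P.Alg c) ≤ 0 :=
    supNorm_le _ (by rw [AlgHom.commutes]; exact Bounded.const c)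
  have h2 : cst (algebraMap ℂ P.Alg c) = c := by
    simp [cst]
  rw [norm_def, h2, le_antisymm h (supNorm_nonneg _), add_zero]

theorem eq_zero_of_norm_eq_zero (x : P.Alg) (h : ‖x‖ = 0) : x = 0 := by
  rw [norm_def] at h
  have h1 : supNorm x = 0 := by linarith [supNorm_nonneg x, norm_nonneg (cst x)]
  have h2 : cst x = 0 := by
    rw [← norm_eq_zero]; linarith [supNorm_nonneg x, norm_nonneg (cst x)]
  apply P.toSeries_injective
  have hz : EqOn (ext x) 0 P.S := by
    intro ζ hζ
    have := (bounded_ext x).2 ζ hζ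
    rw [h1, zero_mul] at this
    simpa using this
  rw [map_zero]
  ext n
  rcases n with _ | n
  · simpa [cst] using h2
  · rw [(bounded_ext x).1.coeff_succ P.hρ,
      (hz.eventuallyEq_of_mem (P.isOpen_S.mem_nhds (zero_mem_sector P.hρ))).iteratedDeriv_eq]
    simp

instance : NormedAddCommGroup P.Alg :=
  AddGroupNorm.toNormedAddCommGroup
    { toFun := fun x => ‖x‖
      map_zero' := by simpa using norm_algebraMap_eq (P := P) 0
      add_le' := norm_add_le_add
      neg' := fun x => by
        refine le_antisymm ?_ ?_
        · simpa using norm_smul_le_mul (-1) x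
        · simpa using norm_smul_le_mul (-1) (-x)
      eq_zero_of_map_eq_zero' := eq_zero_of_norm_eq_zero }

instance : NormedCommRing P.Alg where
  __ := (inferInstance : CommRing P.Alg)
  __ := (inferInstance : NormedAddCommGroup P.Alg)
  norm_mul_le x y := by
    have h : supNorm (x * y) ≤ ‖cst x‖ * supNorm y + ‖cst y‖ * supNorm x + supNorm x * supNorm y :=
      supNorm_le _ (by rw [map_mul]; exact (bounded_ext x).mul (bounded_ext y))
    have h2 : ‖cst (x * y)‖ = ‖cst x‖ * ‖cst y‖ := by simp [cst]
    simp only [norm_def]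
    linarith

instance : NormedAlgebra ℂ P.Alg where
  norm_smul_le := norm_smul_le_mul

instance : NormOneClass P.Alg :=
  ⟨by simpa using norm_algebraMap_eq (P := P) 1⟩

theorem ext_sub (x y : P.Alg) {ζ : ℂ} (hζ : ζ ∈ P.S) : ext (x - y) ζ = ext x ζ - ext y ζ := by
  have h := ((bounded_ext x).add ((bounded_ext y).smul (-1))).1
  rw [eqOn_ext (x - y) (by simpa [sub_eq_add_neg] using h) hζ]
  ring

/-- Weighted uniform limits of holomorphic functions on the sector are holomorphic, and come from
formal series. -/
instance : CompleteSpace P.Alg := by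
  refine Metric.complete_of_cauchySeq_tendsto fun u hu => ?_
  have hsub : ∀ m n, ∀ ζ ∈ P.S, ‖ext (u m) ζ - ext (u n) ζ‖ ≤ ‖u m - u n‖ * P.W ζ := by
    intro m n ζ hζ
    rw [← ext_sub _ _ hζ]
    exact ((bounded_ext _).2 ζ hζ).trans
      (mul_le_mul_of_nonneg_right (supNorm_le_norm _) (P.W_pos ζ).le)
  rw [Metric.cauchySeq_iff'] at hu
  have hu' : ∀ ε > 0, ∃ N, ∀ n ≥ N, ∀ m ≥ N, ‖u n - u m‖ ≤ ε := by
    intro ε hε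
    obtain ⟨N, hN⟩ := hu (ε / 2) (half_pos hε)
    refine ⟨N, fun n hn m hm => ?_⟩
    rw [← dist_eq_norm]
    linarith [dist_triangle_right (u n) (u m) (u N), hN n hn, hN m hm]
  obtain ⟨c, hc⟩ : ∃ c, Tendsto (fun n => cst (u n)) atTop (𝓝 c) := by
    refine cauchySeq_tendsto_of_complete (Metric.cauchySeq_iff'.2 fun ε hε => ?_)
    obtain ⟨N, hN⟩ := hu ε hε
    refine ⟨N, fun n hn => lt_of_le_of_lt ?_ (hN n hn)⟩
    rw [dist_eq_norm, dist_eq_norm]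
    simpa [cst] using norm_cst_le (u n - u N)
  have hg : ∀ ζ, ∃ w, ζ ∈ P.S → Tendsto (fun n => ext (u n) ζ) atTop (𝓝 w) := by
    intro ζ
    by_cases hζ : ζ ∈ P.S
    · obtain ⟨w, hw⟩ := cauchySeq_tendsto_of_complete (u := fun n => ext (u n) ζ)
        (Metric.cauchySeq_iff'.2 fun ε hε => by
          obtain ⟨N, hN⟩ := hu (ε / P.W ζ) (div_pos hε (P.W_pos ζ))
          refine ⟨N, fun n hn => ?_⟩
          rw [dist_eq_norm]
          refine (hsub n N ζ hζ).trans_lt ?_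
          rw [← lt_div_iff₀ (P.W_pos ζ), ← dist_eq_norm]
          exact hN n hn)
      exact ⟨w, fun _ => hw⟩
    · exact ⟨0, fun h => absurd h hζ⟩
  choose g hg using hg
  have hlim : ∀ ε > 0, ∃ N, ∀ n ≥ N, ∀ ζ ∈ P.S, ‖ext (u n) ζ - g ζ‖ ≤ ε * P.W ζ := by
    intro ε hε
    obtain ⟨N, hN⟩ := hu' ε hε
    refine ⟨N, fun n hn ζ hζ => ?_⟩
    refine le_of_tendsto ((tendsto_const_nhds (x := ext (u n) ζ)).sub (hg ζ hζ)).norm ?_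
    filter_upwards [eventually_ge_atTop N] with m hm
    exact (hsub n m ζ hζ).trans (mul_le_mul_of_nonneg_right (hN n hn m hm) (P.W_pos ζ).le)
  have hgd : DifferentiableOn ℂ g P.S := by
    have hloc : TendstoLocallyUniformlyOn (fun n => ext (u n)) g atTop P.S := by
      rw [Metric.tendstoLocallyUniformlyOn_iff]
      intro ε hε ζ₀ _
      obtain ⟨N, hN⟩ := hlim (ε / (P.W ζ₀ + 1)) (div_pos hε (by linarith [P.W_pos ζ₀]))
      have hW : ∀ᶠ ζ in 𝓝 ζ₀, P.W ζ < P.W ζ₀ + 1 :=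
        (continuous_weight.comp continuous_norm).continuousAt.eventually_lt continuousAt_const
          (by simp)
      refine ⟨{ζ | P.W ζ < P.W ζ₀ + 1} ∩ P.S,
        inter_mem (mem_nhdsWithin_of_mem_nhds hW) self_mem_nhdsWithin, ?_⟩
      filter_upwards [eventually_ge_atTop N] with n hn ζ hζ
      rw [dist_comm, dist_eq_norm]
      refine (hN n hn ζ hζ.2).trans_lt ?_
      rw [div_mul_eq_mul_div, div_lt_iff₀ (by linarith [P.W_pos ζ₀])]
      exact mul_lt_mul_of_pos_left hζ.1 hε
    exact hloc.differentiableOn (Eventually.of_forall fun n => (bounded_ext (u n)).1.1) P.isOpen_S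
  obtain ⟨φ, hφc, hφ⟩ := exists_isBorelExtension c hgd
  obtain ⟨N₁, hN₁⟩ := hlim 1 one_pos
  have hφb : P.Bounded φ g (supNorm (u N₁) + 1) := by
    refine ⟨hφ, fun ζ hζ => ?_⟩
    have h1 := hN₁ N₁ le_rfl ζ hζ
    have h2 := (bounded_ext (u N₁)).2 ζ hζ
    have h3 := norm_sub_le (ext (u N₁) ζ) (ext (u N₁) ζ - g ζ)
    rw [sub_sub_cancel] at h3
    linarith
  refine ⟨P.ofBounded hφb, ?_⟩
  rw [tendsto_iff_norm_sub_tendsto_zero]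
  rw [tendsto_iff_norm_sub_tendsto_zero] at hc
  have hsup : Tendsto (fun n => supNorm (u n - P.ofBounded hφb)) atTop (𝓝 0) := by
    rw [Metric.tendsto_atTop]
    intro ε hε
    obtain ⟨N, hN⟩ := hlim (ε / 2) (half_pos hε)
    refine ⟨N, fun n hn => ?_⟩
    rw [Real.dist_0_eq_abs, abs_of_nonneg (supNorm_nonneg _)]
    refine lt_of_le_of_lt (supNorm_le _ ⟨(bounded_ext _).1, fun ζ hζ => ?_⟩) (half_lt_self hε)
    rw [ext_sub _ _ hζ, eqOn_ext (P.ofBounded hφb) hφ hζ]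
    exact hN n hn ζ hζ
  have hsum := hc.add hsup
  rw [add_zero] at hsum
  refine hsum.congr fun n => ?_
  rw [norm_def]
  simp [cst, hφc]

/-- The coefficients of the series depend continuously on it, by Cauchy's estimates. -/
theorem exists_norm_coeff_le (n : ℕ) :
    ∃ K : ℝ, ∀ x : P.Alg, ‖PowerSeries.coeff n (P.toSeries x)‖ ≤ K * ‖x‖ := by
  rcases n with _ | n
  · exact ⟨1, fun x => by simpa [cst] using norm_cst_le x⟩
  · have hr : 0 < P.ρ / 2 := half_pos P.hρ
    refine ⟨n.factorial * weight P.M P.ν (P.ρ / 2) / (P.ρ / 2) ^ n, fun x => ?_⟩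
    have hsub : Metric.closedBall (0 : ℂ) (P.ρ / 2) ⊆ P.S :=
      (Metric.closedBall_subset_ball (half_lt_self P.hρ)).trans subset_union_left
    rw [(bounded_ext x).1.coeff_succ P.hρ]
    refine (Complex.norm_iteratedDeriv_le_of_forall_mem_sphere_norm_le n hr
      (((bounded_ext x).1.1.mono hsub).diffContOnCl_ball subset_rfl)
      (C := ‖x‖ * weight P.M P.ν (P.ρ / 2)) fun ζ hζ => ?_).trans_eq (by ring)
    have h := (bounded_ext x).2 ζ (hsub (Metric.sphere_subset_closedBall hζ))
    rw [W, mem_sphere_zero_iff_norm.1 hζ] at h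
    exact h.trans (mul_le_mul_of_nonneg_right (supNorm_le_norm x) (weight_pos P.hM _ _).le)

/-- The coefficients of the series, as continuous linear maps. -/
def coeffL (n : ℕ) : P.Alg →L[ℂ] ℂ :=
  LinearMap.mkContinuousOfExistsBound ((PowerSeries.coeff n).comp P.toSeries.toLinearMap)
    (exists_norm_coeff_le n)

theorem coeffL_apply (n : ℕ) (x : P.Alg) : coeffL n x = PowerSeries.coeff n (P.toSeries x) := rfl

theorem norm_ext_le_exp (x : P.Alg) :
    ∀ ζ ∈ P.S, ‖ext x ζ‖ ≤ supNorm x * (P.M / 8) * Real.exp (P.ν * ‖ζ‖) := by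
  intro ζ hζ
  rw [mul_assoc]
  exact ((bounded_ext x).2 ζ hζ).trans
    (mul_le_mul_of_nonneg_left (weight_le P.hM _ _) (supNorm_nonneg x))

theorem integrableOn_laplaceIntegrand_ext (x : P.Alg) {θ : ℝ} (hθ : θ ∈ P.𝒜) {z : ℂ}
    (hz : P.ν < (z * Complex.exp (Complex.I * (θ : ℂ))).re) :
    IntegrableOn (laplaceIntegrand (ext x) θ z) (Ioi 0) :=
  integrableOn_laplaceIntegrand (bounded_ext x).1.1.continuousOn (norm_ext_le_exp x) hθ hz

theorem norm_laplace_ext_le (x : P.Alg) {θ : ℝ} (hθ : θ ∈ P.𝒜) {z : ℂ}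
    (hz : P.ν < (z * Complex.exp (Complex.I * (θ : ℂ))).re) :
    ‖laplace (ext x) θ z‖ ≤ supNorm x := by
  obtain ⟨h1, h2⟩ := integrableOn_weight_mul_exp (ν := P.ν) P.hM hz.le
  have h := norm_integral_le_of_norm_le (f := laplaceIntegrand (ext x) θ z)
    (h1.const_mul (supNorm x)) (by
      filter_upwards [self_mem_ae_restrict measurableSet_Ioi] with t ht
      have ht' : (0 : ℝ) < t := ht
      have h3 := (bounded_ext x).2 _ (ray_mem_sector (ρ := P.ρ) hθ ht')
      rw [W, norm_ofReal_mul_exp, abs_of_pos ht'] at h3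
      rw [norm_laplaceIntegrand, ← mul_assoc]
      gcongr)
  rw [integral_const_mul] at h
  exact h.trans (mul_le_of_le_one_right (supNorm_nonneg x) h2)

/-- The Laplace transform (with the constant term) in the direction `θ` at `z`. -/
def lap (θ : ℝ) (z : ℂ) (x : P.Alg) : ℂ := cst x + laplace (ext x) θ z

theorem norm_lap_le (x : P.Alg) {θ : ℝ} (hθ : θ ∈ P.𝒜) {z : ℂ}
    (hz : P.ν < (z * Complex.exp (Complex.I * (θ : ℂ))).re) : ‖lap θ z x‖ ≤ ‖x‖ :=
  (norm_add_le _ _).trans (add_le_add_right (norm_laplace_ext_le x hθ hz) _)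

theorem lap_add (x y : P.Alg) {θ : ℝ} (hθ : θ ∈ P.𝒜) {z : ℂ}
    (hz : P.ν < (z * Complex.exp (Complex.I * (θ : ℂ))).re) :
    lap θ z (x + y) = lap θ z x + lap θ z y := by
  have h : laplace (ext (x + y)) θ z = laplace (ext x) θ z + laplace (ext y) θ z := by
    rw [laplace, laplace, laplace, ← integral_add (integrableOn_laplaceIntegrand_ext x hθ hz)
      (integrableOn_laplaceIntegrand_ext y hθ hz)]
    refine setIntegral_congr_fun measurableSet_Ioi fun t ht => ?_
    have he := eqOn_ext (x + y) (by rw [map_add]; exact ((bounded_ext x).add (bounded_ext y)).1)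
      (ray_mem_sector (ρ := P.ρ) hθ ht)
    simp only [laplaceIntegrand, he]
    ring
  simp only [lap, h, cst, map_add]
  ring

theorem lap_mul (x y : P.Alg) {θ : ℝ} (hθ : θ ∈ P.𝒜) {z : ℂ}
    (hz : P.ν < (z * Complex.exp (Complex.I * (θ : ℂ))).re) :
    lap θ z (x * y) = lap θ z x * lap θ z y := by
  have hx := integrableOn_laplaceIntegrand_ext x hθ hz
  have hy := integrableOn_laplaceIntegrand_ext y hθ hz
  have hxy := integrableOn_laplaceIntegrand_ext (x * y) hθ hz
  have hsum : IntegrableOn (fun t => cst x * laplaceIntegrand (ext y) θ z t +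
      cst y * laplaceIntegrand (ext x) θ z t) (Ioi 0) := (hy.const_mul _).add (hx.const_mul _)
  have h : laplace (conv (ext x) (ext y)) θ z = laplace (ext (x * y)) θ z -
      (cst x * laplace (ext y) θ z + cst y * laplace (ext x) θ z) := by
    simp only [laplace]
    rw [← integral_const_mul, ← integral_const_mul,
      ← integral_add (hy.const_mul _) (hx.const_mul _),
      ← integral_sub hxy hsum]
    refine setIntegral_congr_fun measurableSet_Ioi fun t ht => ?_
    have he := eqOn_ext (x * y) (by rw [map_mul]; exact ((bounded_ext x).mul (bounded_ext y)).1)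
      (ray_mem_sector (ρ := P.ρ) hθ ht)
    simp only [laplaceIntegrand, he, cst]
    ring
  rw [laplace_conv hx hy] at h
  have hc : cst (x * y) = cst x * cst y := by simp [cst]
  simp only [lap, hc]
  linear_combination -h

/-- The Laplace transform in the direction `θ` at `z` is a continuous character of the algebra. -/
theorem exists_lap_eq {θ : ℝ} (hθ : θ ∈ P.𝒜) {z : ℂ}
    (hz : P.ν < (z * Complex.exp (Complex.I * (θ : ℂ))).re) :
    ∃ Λ : P.Alg →A[ℂ] ℂ, ∀ x, Λ x = lap θ z x := by
  have hc : ∀ c, lap θ z (algebraMap ℂ P.Alg c) = c := by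
    intro c
    have h := norm_laplace_ext_le (algebraMap ℂ P.Alg c) hθ hz
    have h2 := norm_algebraMap_eq (P := P) c
    have h3 : cst (algebraMap ℂ P.Alg c) = c := by simp [cst]
    rw [norm_def, h3, add_eq_left] at h2
    rw [h2, norm_le_zero_iff] at h
    rw [lap, h, h3, add_zero]
  let Λ : P.Alg →ₐ[ℂ] ℂ :=
    { toFun := lap θ z
      map_one' := by simpa using hc 1
      map_mul' := fun x y => lap_mul x y hθ hz
      map_zero' := by simpa using hc 0
      map_add' := fun x y => lap_add x y hθ hz
      commutes' := hc }
  exact ⟨⟨Λ, (Λ.toLinearMap.mkContinuous 1 fun x => by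
    simpa [Λ] using norm_lap_le x hθ hz).continuous⟩, fun _ => rfl⟩

end WeightedSector

/-! ### A small root of a power series over a Banach algebra -/

section Root

variable {R : Type*} [NormedCommRing R] [NormOneClass R]

theorem norm_pow_succ_sub_pow_succ_le {x y : R} {r : ℝ} (hx : ‖x‖ ≤ r) (hy : ‖y‖ ≤ r) (k : ℕ) :
    ‖x ^ (k + 1) - y ^ (k + 1)‖ ≤ (2 * r) ^ k * ‖x - y‖ := by
  have hr : 0 ≤ r := (norm_nonneg _).trans hx
  induction k with
  | zero => simp
  | succ k ih =>
    have e : x ^ (k + 1 + 1) - y ^ (k + 1 + 1) =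
        x * (x ^ (k + 1) - y ^ (k + 1)) + y ^ (k + 1) * (x - y) := by ring
    have h1 : ‖y ^ (k + 1)‖ ≤ r ^ (k + 1) :=
      (norm_pow_le _ _).trans (pow_le_pow_left₀ (norm_nonneg _) hy _)
    have h2 : r ^ (k + 1) ≤ r * (2 * r) ^ k := by
      rw [pow_succ', mul_pow]
      have : (1 : ℝ) ≤ 2 ^ k := one_le_pow₀ one_le_two
      exact mul_le_mul_of_nonneg_left (le_mul_of_one_le_left (by positivity) this) hr
    rw [e]
    calc _ ≤ ‖x‖ * ‖x ^ (k + 1) - y ^ (k + 1)‖ + ‖y ^ (k + 1)‖ * ‖x - y‖ :=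
          (norm_add_le _ _).trans (add_le_add (norm_mul_le _ _) (norm_mul_le _ _))
      _ ≤ r * ((2 * r) ^ k * ‖x - y‖) + r * (2 * r) ^ k * ‖x - y‖ := by
          gcongr
          exact h1.trans h2
      _ = _ := by ring

variable [CompleteSpace R]

theorem summable_mul_pow {a : ℕ → R} {A B r : ℝ} (hB : 0 < B)
    (ha : ∀ k, ‖a k‖ ≤ A * B ^ k) (hr : B * r < 1) {x : R} (hx : ‖x‖ ≤ r) :
    Summable fun k => a k * x ^ k := by
  have hr0 : 0 ≤ r := (norm_nonneg _).trans hx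
  refine Summable.of_norm_bounded ((summable_geometric_of_lt_one (by positivity) hr).mul_left A)
    fun k => ?_
  rw [mul_pow, ← mul_assoc]
  exact (norm_mul_le _ _).trans (mul_le_mul (ha k)
    ((norm_pow_le _ _).trans (pow_le_pow_left₀ (norm_nonneg _) hx _)) (norm_nonneg _)
    ((norm_nonneg _).trans (ha k)))

/-- Over a Banach algebra, a power series `∑ aₖ xᵏ` with `a₀` small and `a₁` close to a nonzero
constant `c` has a small root `x`, which is the fixed point of the contraction
`x ↦ x - c⁻¹ ∑ aₖ xᵏ`. A character which vanishes at `a₀` vanishes at the root. -/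
theorem exists_root [NormedAlgebra ℂ R] {a : ℕ → R} {c : ℂ} {A B r : ℝ} (hc : c ≠ 0)
    (hA : 0 ≤ A) (hB : 0 < B) (hr : 0 < r) (ha : ∀ k, ‖a k‖ ≤ A * B ^ k) (hBr : B * r ≤ 1 / 4)
    (hABr : A * B ^ 2 * r ≤ ‖c‖ / 16) (h0 : ‖a 0‖ ≤ ‖c‖ * r / 2)
    (h1 : ‖a 1 - algebraMap ℂ R c‖ ≤ ‖c‖ / 4) (χ : R →A[ℂ] ℂ) (hχ : χ (a 0) = 0) :
    ∃ x : R, ‖x‖ ≤ r ∧ χ x = 0 ∧ ∑' k, a k * x ^ k = 0 := by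
  have hc' : 0 < ‖c‖ := norm_pos_iff.2 hc
  have hBr1 : B * r < 1 := by linarith
  have hsum : ∀ {x : R}, ‖x‖ ≤ r → Summable fun k => a k * x ^ k :=
    fun hx => summable_mul_pow hB ha hBr1 hx
  let T : R → R := fun x => x - c⁻¹ • ∑' k, a k * x ^ k
  have hlip : ∀ x y : R, ‖x‖ ≤ r → ‖y‖ ≤ r → ‖T x - T y‖ ≤ 1 / 2 * ‖x - y‖ := by
    intro x y hx hy
    -- the first two terms of the series are split off
    have hd : ∑' k, a k * x ^ k - ∑' k, a k * y ^ k =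
        a 1 * (x - y) + ∑' k, a (k + 2) * (x ^ (k + 2) - y ^ (k + 2)) := by
      rw [← (hsum hx).tsum_sub (hsum hy), ← ((hsum hx).sub (hsum hy)).sum_add_tsum_nat_add 2]
      simp [Finset.sum_range_succ, mul_sub]
    have he : T x - T y = -(c⁻¹ • ((a 1 - algebraMap ℂ R c) * (x - y) +
        ∑' k, a (k + 2) * (x ^ (k + 2) - y ^ (k + 2)))) := by
      have e1 : T x - T y = (x - y) - c⁻¹ • (∑' k, a k * x ^ k - ∑' k, a k * y ^ k) := by
        simp only [T, smul_sub]; abel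
      have e2 : c⁻¹ • (algebraMap ℂ R c * (x - y)) = x - y := by
        rw [← Algebra.smul_def, smul_smul, inv_mul_cancel₀ hc, one_smul]
      rw [e1, hd, sub_mul, smul_add, smul_add, smul_sub, e2]
      abel
    have hgeo : HasSum (fun k : ℕ => A * B * (2 * (B * r)) * (2 * (B * r)) ^ k * ‖x - y‖)
        (A * B * (2 * (B * r)) * (1 - 2 * (B * r))⁻¹ * ‖x - y‖) :=
      ((hasSum_geometric_of_lt_one (by positivity) (by linarith)).mul_left _).mul_right _
    have htail : ‖∑' k, a (k + 2) * (x ^ (k + 2) - y ^ (k + 2))‖ ≤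
        A * B * (2 * (B * r)) * (1 - 2 * (B * r))⁻¹ * ‖x - y‖ := by
      refine tsum_of_norm_bounded hgeo fun k => ?_
      calc _ ≤ A * B ^ (k + 2) * ((2 * r) ^ (k + 1) * ‖x - y‖) :=
            (norm_mul_le _ _).trans (mul_le_mul (ha _) (norm_pow_succ_sub_pow_succ_le hx hy (k + 1))
              (norm_nonneg _) (by positivity))
        _ = _ := by ring
    have hinv : (1 - 2 * (B * r))⁻¹ ≤ 2 := by
      rw [inv_le_comm₀ (by linarith) two_pos]
      linarith
    rw [he, norm_neg, norm_smul, norm_inv, inv_mul_le_iff₀ hc']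
    calc _ ≤ ‖c‖ / 4 * ‖x - y‖ + A * B * (2 * (B * r)) * 2 * ‖x - y‖ := by
          refine (norm_add_le _ _).trans (add_le_add ?_ (htail.trans ?_))
          · exact (norm_mul_le _ _).trans (mul_le_mul_of_nonneg_right h1 (norm_nonneg _))
          · gcongr
      _ ≤ ‖c‖ / 4 * ‖x - y‖ + ‖c‖ / 4 * ‖x - y‖ := by
          gcongr
          linarith
      _ = _ := by ring
  have hT0 : ‖T 0‖ ≤ r / 2 := by
    have : T 0 = -(c⁻¹ • a 0) := by
      simp only [T, zero_sub, neg_inj]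
      rw [tsum_eq_single 0 fun k hk => by simp [hk]]
      simp
    rw [this, norm_neg, norm_smul, norm_inv, inv_mul_le_iff₀ hc']
    linarith
  set s : Set R := Metric.closedBall 0 r ∩ {x | χ x = 0} with hs
  have hsc : IsComplete s :=
    (Metric.isClosed_closedBall.inter
      (isClosed_eq χ.continuous continuous_const)).isComplete
  have hmaps : MapsTo T s s := by
    rintro x ⟨hx, hx'⟩
    rw [mem_closedBall_zero_iff] at hx
    refine ⟨?_, ?_⟩
    · rw [mem_closedBall_zero_iff]
      have h2 := hlip x 0 hx (by simpa using hr.le)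
      have h3 := norm_add_le (T x - T 0) (T 0)
      rw [sub_add_cancel] at h3
      rw [sub_zero] at h2
      linarith
    · have hx0 : χ x = 0 := hx'
      have h4 := ((hsum hx).hasSum.map χ χ.continuous).tsum_eq
      have h5 : ∑' k, (χ ∘ fun k => a k * x ^ k) k = 0 := by
        rw [tsum_eq_single 0 fun k hk => by simp [hx0, hk]]
        simp [hχ]
      rw [h5] at h4
      show χ (T x) = 0
      simp only [T, map_sub, map_smul, ← h4, hx0, smul_zero, sub_zero]
  have hcontr : ContractingWith (1 / 2) (hmaps.restrict T s s) := by
    refine ⟨by rw [← NNReal.coe_lt_coe]; norm_num, LipschitzWith.of_dist_le_mul fun x y => ?_⟩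
    have := hlip x y (mem_closedBall_zero_iff.1 x.2.1) (mem_closedBall_zero_iff.1 y.2.1)
    simpa [Subtype.dist_eq, dist_eq_norm] using this
  obtain ⟨x, hxs, hfix, -⟩ := hcontr.exists_fixedPoint' hsc hmaps (x := 0)
    ⟨Metric.mem_closedBall_self hr.le, by simp⟩ (edist_ne_top _ _)
  refine ⟨x, mem_closedBall_zero_iff.1 hxs.1, hxs.2, ?_⟩
  have h6 : c⁻¹ • ∑' k, a k * x ^ k = 0 := by simpa [T] using sub_eq_self.1 hfix
  exact (smul_eq_zero.1 h6).resolve_left (inv_ne_zero hc)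

end Root

/-! ### Formal solutions -/

section Formal

variable {F : ℂ⟦X⟧⟦X⟧} {φ ψ : ℂ⟦X⟧}

theorem coeff_mul_pow_eq_zero (hφ : PowerSeries.constantCoeff φ = 0) (f : ℂ⟦X⟧) {n k : ℕ}
    (h : n < k) : PowerSeries.coeff n (f * φ ^ k) = 0 := by
  have h1 : (PowerSeries.X : ℂ⟦X⟧) ∣ φ := PowerSeries.X_dvd_iff.2 hφ
  exact PowerSeries.X_pow_dvd_iff.1 (Dvd.dvd.mul_left (pow_dvd_pow_of_dvd h1 k) f) n h

theorem coeff_formalSubst (hφ : PowerSeries.constantCoeff φ = 0) {n N : ℕ} (h : n < N) :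
    PowerSeries.coeff n (formalSubst F φ) =
      ∑ k ∈ Finset.range N, PowerSeries.coeff n (PowerSeries.coeff k F * φ ^ k) := by
  rw [formalSubst, PowerSeries.coeff_mk]
  refine finsum_eq_sum_of_support_subset _ fun k hk => ?_
  rw [Finset.coe_range, mem_Iio]
  by_contra hk'
  exact hk (coeff_mul_pow_eq_zero hφ _ (h.trans_le (not_lt.1 hk')))

/-- The formal solution is unique: the first coefficient at which two solutions would differ is
multiplied in the equation by the constant term of `F₁`. -/
theorem IsFormalSolution.unique (hF1 : PowerSeries.constantCoeff (PowerSeries.coeff 1 F) ≠ 0)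
    (hφ : IsFormalSolution F φ) (hψ : IsFormalSolution F ψ) : φ = ψ := by
  ext n
  induction n using Nat.strong_induction_on with
  | _ n ih =>
    rcases n with _ | n
    · simp [hφ.1, hψ.1]
    have hXφ : (PowerSeries.X : ℂ⟦X⟧) ∣ φ := PowerSeries.X_dvd_iff.2 hφ.1
    have hXψ : (PowerSeries.X : ℂ⟦X⟧) ∣ ψ := PowerSeries.X_dvd_iff.2 hψ.1
    have hd : (PowerSeries.X : ℂ⟦X⟧) ^ (n + 1) ∣ φ - ψ := by
      rw [PowerSeries.X_pow_dvd_iff]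
      intro m hm
      rw [map_sub, ih m hm, sub_self]
    have h := coeff_formalSubst (F := F) hφ.1 (show n + 1 < n + 2 by omega)
    have h' := coeff_formalSubst (F := F) hψ.1 (show n + 1 < n + 2 by omega)
    rw [hφ.2, map_zero] at h
    rw [hψ.2, map_zero] at h'
    have h2 : ∑ k ∈ Finset.range (n + 2),
        PowerSeries.coeff (n + 1) (PowerSeries.coeff k F * (φ ^ k - ψ ^ k)) = 0 := by
      simp only [mul_sub, map_sub, Finset.sum_sub_distrib, ← h, ← h', sub_self]
    rw [Finset.sum_eq_single 1] at h2
    · obtain ⟨q, hq⟩ := hd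
      rw [pow_one, pow_one, hq, mul_left_comm, PowerSeries.coeff_X_pow_mul', if_pos le_rfl,
        Nat.sub_self, PowerSeries.coeff_zero_eq_constantCoeff, map_mul] at h2
      have h3 : PowerSeries.coeff (n + 1) (φ - ψ) = 0 := by
        rw [hq, PowerSeries.coeff_X_pow_mul', if_pos le_rfl, Nat.sub_self,
          PowerSeries.coeff_zero_eq_constantCoeff]
        exact (mul_eq_zero.1 h2).resolve_left hF1
      rwa [map_sub, sub_eq_zero] at h3
    · intro k _ hk
      rcases k with _ | _ | k
      · simp
      · exact absurd rfl hk
      have e : φ ^ (k + 2) - ψ ^ (k + 2) =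
          (φ ^ (k + 1) - ψ ^ (k + 1)) * φ + (φ - ψ) * ψ ^ (k + 1) := by ring
      have h4 : (PowerSeries.X : ℂ⟦X⟧) ^ (n + 2) ∣ φ ^ (k + 2) - ψ ^ (k + 2) := by
        rw [e, pow_succ _ (n + 1)]
        exact dvd_add (mul_dvd_mul (hd.trans (sub_dvd_pow_sub_pow _ _ _)) hXφ)
          (mul_dvd_mul hd (hXψ.trans (dvd_pow_self _ k.succ_ne_zero)))
      exact PowerSeries.X_pow_dvd_iff.1 (Dvd.dvd.mul_left h4 _) _ (by omega)
    · intro h5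
      exact absurd (Finset.mem_range.2 (by omega)) h5

end Formal

/-! ### The implicit function theorem -/

open WeightedSector in
/-- There is a solution in the Banach algebra of a weighted sector of large enough parameters. -/
theorem exists_solution {𝒜 : Set ℝ} (hopen : ∀ r : ℝ, 0 < r → IsOpen (sector 𝒜 r))
    {F : ℂ⟦X⟧⟦X⟧} {ρ τ A B : ℝ} (hρ : 0 < ρ) (hA : 0 < A) (hB : 0 < B)
    (hF : ∀ k : ℕ, ∃ g, IsBorelExtension 𝒜 ρ (PowerSeries.coeff k F) g ∧
      ‖PowerSeries.constantCoeff (PowerSeries.coeff k F)‖ ≤ A * B ^ k ∧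
      ∀ ζ ∈ sector 𝒜 ρ, ‖g ζ‖ ≤ A * B ^ k * Real.exp (τ * ‖ζ‖))
    (hF0 : PowerSeries.constantCoeff (PowerSeries.coeff 0 F) = 0)
    (hF1 : PowerSeries.constantCoeff (PowerSeries.coeff 1 F) ≠ 0) :
    ∃ (P : WeightedSector) (_ : P.𝒜 = 𝒜) (_ : P.ρ = ρ) (_ : τ ≤ P.ν) (f : ℕ → P.Alg) (x : P.Alg),
      (∀ k, P.toSeries (f k) = PowerSeries.coeff k F) ∧ cst x = 0 ∧ ‖x‖ < 1 / B ∧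
      HasSum (fun k => f k * x ^ k) 0 := by
  set c := PowerSeries.constantCoeff (PowerSeries.coeff 1 F) with hc
  have hc' : 0 < ‖c‖ := norm_pos_iff.2 hF1
  obtain ⟨r, hr, hr1, hr2⟩ : ∃ r : ℝ, 0 < r ∧ B * r ≤ 1 / 4 ∧ 2 * A * B ^ 2 * r ≤ ‖c‖ / 16 := by
    refine ⟨min (1 / 4 / B) (‖c‖ / 16 / (2 * A * B ^ 2)), by positivity, ?_, ?_⟩
    · rw [mul_comm, ← le_div_iff₀ hB]; exact min_le_left _ _
    · rw [mul_comm, ← le_div_iff₀ (by positivity)]; exact min_le_right _ _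
  obtain ⟨N, hN1, hN2, hN3⟩ : ∃ N : ℝ, 1 ≤ N ∧ A / N ≤ ‖c‖ * r / 2 ∧ A * B / N ≤ ‖c‖ / 4 := by
    refine ⟨max 1 (max (A / (‖c‖ * r / 2)) (A * B / (‖c‖ / 4))), le_max_left _ _, ?_, ?_⟩
    · rw [div_le_comm₀ (by positivity) (by positivity)]
      exact (le_max_left _ _).trans (le_max_right _ _)
    · rw [div_le_comm₀ (by positivity) (by positivity)]
      exact (le_max_right _ _).trans (le_max_right _ _)
  have hN : 0 < N := one_pos.trans_le hN1
  -- for these parameters the weight is at least `N exp (τ r)`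
  let P : WeightedSector := ⟨𝒜, ρ, 8 * N, τ + 2 * (8 * N), hρ, by positivity, hopen⟩
  choose g hg hgc hgb using hF
  have hb : ∀ k, P.Bounded (PowerSeries.coeff k F) (g k) (A * B ^ k / N) := by
    refine fun k => ⟨hg k, fun ζ hζ => (hgb k ζ hζ).trans ?_⟩
    have := mul_exp_le_weight (τ := τ) hN (norm_nonneg ζ)
    calc _ = A * B ^ k / N * (N * Real.exp (τ * ‖ζ‖)) := by field_simp
      _ ≤ _ := mul_le_mul_of_nonneg_left this (by positivity)
  let f : ℕ → P.Alg := fun k => P.ofBounded (hb k)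
  have hfs : ∀ k, supNorm (f k) ≤ A * B ^ k / N := fun k => supNorm_le _ (hb k)
  have hfn : ∀ k, ‖f k‖ ≤ 2 * A * B ^ k := by
    intro k
    have h1 : A * B ^ k / N ≤ A * B ^ k := div_le_self (by positivity) hN1
    have h2 : ‖cst (f k)‖ ≤ A * B ^ k := hgc k
    rw [norm_def]
    linarith [hfs k]
  have hf1 : ‖f 1 - algebraMap ℂ P.Alg c‖ ≤ ‖c‖ / 4 := by
    have h1 : cst (f 1 - algebraMap ℂ P.Alg c) = 0 := by simp [cst, f, hc]
    have h2 := (hb 1).add ((Bounded.const (P := P) c).smul (-1))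
    have h3 : supNorm (f 1 - algebraMap ℂ P.Alg c) ≤ A * B ^ 1 / N + ‖(-1 : ℂ)‖ * 0 := by
      refine supNorm_le _ (g := fun ζ => g 1 ζ + -1 * 0) ?_
      rw [map_sub, AlgHom.commutes, sub_eq_add_neg, ← neg_one_smul ℂ]
      exact h2
    rw [norm_def, h1, norm_zero, zero_add]
    rw [mul_zero, add_zero, pow_one] at h3
    exact h3.trans hN3
  have hf0 : ‖f 0‖ ≤ ‖c‖ * r / 2 := by
    have h1 : cst (f 0) = 0 := hF0
    have h2 := hfs 0
    rw [pow_zero, mul_one] at h2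
    rw [norm_def, h1, norm_zero, zero_add]
    exact h2.trans hN2
  let χ : P.Alg →A[ℂ] ℂ :=
    ⟨{ toFun := cst
       map_one' := by simp [cst]
       map_mul' := fun x y => by simp [cst]
       map_zero' := by simp [cst]
       map_add' := fun x y => by simp [cst]
       commutes' := fun c => by simp [cst] }, by
      have : (cst : P.Alg → ℂ) = coeffL 0 := by
        funext x
        rw [coeffL_apply, PowerSeries.coeff_zero_eq_constantCoeff]
        rfl
      simpa [this] using (coeffL (P := P) 0).continuous⟩
  obtain ⟨x, hx, hx0, hxs⟩ := exists_root hF1 (by positivity) hB hr hfn hr1 hr2 hf0 hf1 χ hF0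
  have hxB : ‖x‖ < 1 / B := by
    rw [lt_div_iff₀ hB]
    nlinarith
  refine ⟨P, rfl, rfl, ?_, f, x, fun k => rfl, hx0, hxB, ?_⟩
  · simp only [P]
    linarith
  · rw [← hxs]
    exact (summable_mul_pow hB hfn (by linarith) hx).hasSum

open WeightedSector in
theorem isFormalSolution_toSeries {F : ℂ⟦X⟧⟦X⟧} {P : WeightedSector} {f : ℕ → P.Alg} {x : P.Alg}
    (hf : ∀ k, P.toSeries (f k) = PowerSeries.coeff k F) (hx : cst x = 0)
    (hsum : HasSum (fun k => f k * x ^ k) 0) : IsFormalSolution F (P.toSeries x) := by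
  refine ⟨hx, ?_⟩
  ext n
  rw [coeff_formalSubst (F := F) hx (Nat.lt_succ_self n), map_zero]
  have h := (hsum.mapL (coeffL n)).tsum_eq
  rw [map_zero, tsum_eq_sum (s := Finset.range n.succ) fun k hk => by
    rw [coeffL_apply, map_mul, map_pow]
    exact coeff_mul_pow_eq_zero hx _ (by simpa using hk)] at h
  rw [← h]
  refine Finset.sum_congr rfl fun k _ => ?_
  rw [← hf, coeffL_apply, map_mul P.toSeries, map_pow P.toSeries]

end BorelLaplace

end

open BorelLaplace BorelLaplace.WeightedSector in
theorem theorem4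
    -- a non-trivial interval of directions
    (𝒜 : Set ℝ) (h𝒜 : 𝒜.OrdConnected) (h𝒜' : 𝒜.Nontrivial)
    (hopen : ∀ r : ℝ, 0 < r → IsOpen (BorelLaplace.sector 𝒜 r))
    (F : PowerSeries (PowerSeries ℂ)) (ρ τ A B : ℝ) (hρ : 0 < ρ) (hA : 0 < A) (hB : 0 < B)
    (hF : ∀ k : ℕ, BorelLaplace.expNorm 𝒜 ρ τ (PowerSeries.coeff k F) ≤ ENNReal.ofReal (A * B ^ k))
    (hF0 : PowerSeries.constantCoeff (PowerSeries.coeff 0 F) = 0)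
    (hF1 : PowerSeries.constantCoeff (PowerSeries.coeff 1 F) ≠ 0) :
    -- the series of Borel sums is well defined and holomorphic, on the domain of parameter `τ`
    -- and on those of larger parameters
    (∀ σ : ℝ, τ ≤ σ →
      (∀ k : ℕ, BorelLaplace.BorelSumWellDefined 𝒜 σ (PowerSeries.coeff k F)) ∧
      (∀ p ∈ BorelLaplace.sumDomain 𝒜 σ, ∀ y ∈ Metric.ball (0 : ℂ) (1 / B),
        Summable fun k : ℕ => BorelLaplace.borelSum 𝒜 σ (PowerSeries.coeff k F) p * y ^ k) ∧
      DifferentiableOn ℂ (fun q : ℂ × ℂ => BorelLaplace.sumSeries 𝒜 σ F q.1 q.2)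
        (BorelLaplace.sumDomain 𝒜 σ ×ˢ Metric.ball (0 : ℂ) (1 / B))) ∧
    -- there is a unique formal solution
    (∃! φ : PowerSeries ℂ, BorelLaplace.IsFormalSolution F φ) ∧
    -- it is `1`-summable and its Borel sum is a holomorphic solution
    ∀ φ : PowerSeries ℂ, BorelLaplace.IsFormalSolution F φ →
      BorelLaplace.OneSummable 𝒜 φ ∧
      ∃ τ₀ : ℝ, τ ≤ τ₀ ∧ ∀ τ' : ℝ, τ₀ ≤ τ' →
        BorelLaplace.BorelSumWellDefined 𝒜 τ' φ ∧
        DifferentiableOn ℂ (BorelLaplace.borelSum 𝒜 τ' φ) (BorelLaplace.sumDomain 𝒜 τ') ∧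
        ∀ p ∈ BorelLaplace.sumDomain 𝒜 τ',
          BorelLaplace.borelSum 𝒜 τ' φ p ∈ Metric.ball (0 : ℂ) (1 / B) ∧
          BorelLaplace.sumSeries 𝒜 τ' F p (BorelLaplace.borelSum 𝒜 τ' φ p) = 0 := by

  have hF' := fun k => exists_of_expNorm_le hopen hρ (by positivity) (hF k)
  obtain ⟨P, rfl, rfl, hν, f, x, hf, hx, hxB, hsum⟩ :=
    exists_solution hopen hρ hA hB hF' hF0 hF1
  have hsol := isFormalSolution_toSeries hf hx hsum
  choose g hg hgc hgb using hF'
  refine ⟨fun σ hσ => ⟨fun k => borelSumWellDefined h𝒜 hopen hρ (hg k) (hgb k) hσ, ?_, ?_⟩,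
    ⟨P.toSeries x, hsol, fun ψ hψ => hψ.unique hF1 hsol⟩, ?_⟩
  · intro p hp y hy
    obtain ⟨η, hη, V, hVo, hpV, hV⟩ := exists_nhds_borelSum h𝒜 hopen hρ hσ hp
    have hbd : ∀ k, ‖borelSum P.𝒜 σ (PowerSeries.coeff k F) p‖ ≤ (A + A / η) * B ^ k := fun k =>
      ((hV _ _ _ (hg k) (hgb k)).2 p hpV).trans (by
        have := hgc k
        calc _ ≤ A * B ^ k + A * B ^ k / η := by gcongr
          _ = _ := by ring)
    have hy' : ‖y‖ < 1 / B := mem_ball_zero_iff.1 hy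
    exact summable_mul_pow hB hbd (by rwa [lt_div_iff₀ hB, mul_comm] at hy') le_rfl
  · rintro ⟨p, y⟩ ⟨hp, hy⟩
    obtain ⟨η, hη, V, hVo, hpV, hV⟩ := exists_nhds_borelSum h𝒜 hopen hρ hσ hp
    refine (differentiableAt_tsum_mul_pow (D := A + A / η) hB hVo
      (fun k => (hV _ _ _ (hg k) (hgb k)).1) (fun k p hp => ?_) hpV
      (mem_ball_zero_iff.1 hy)).differentiableWithinAt
    refine ((hV _ _ _ (hg k) (hgb k)).2 p hp).trans ?_
    have := hgc k
    calc _ ≤ A * B ^ k + A * B ^ k / η := by gcongr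
      _ = _ := by ring
  · intro φ hφ
    obtain rfl : φ = P.toSeries x := hφ.unique hF1 hsol
    refine ⟨⟨P.ρ, hρ, ext x, (bounded_ext x).1, P.ν, supNorm x * (P.M / 8) + 1, ?_, ?_⟩,
      P.ν, hν, fun τ' hτ' => ⟨?_, ?_, ?_⟩⟩
    · have := supNorm_nonneg x
      have := P.hM
      positivity
    · intro ζ hζ
      refine (norm_ext_le_exp x ζ hζ).trans ?_
      gcongr
      linarith
    · exact borelSumWellDefined h𝒜 hopen hρ (bounded_ext x).1 (norm_ext_le_exp x) hτ'
    · exact differentiableOn_borelSum h𝒜 hopen hρ (bounded_ext x).1 (norm_ext_le_exp x) hτ'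
    · rintro p ⟨θ, hθ⟩
      obtain ⟨Λ, hΛ⟩ := exists_lap_eq (P := P) hθ.1 (hτ'.trans_lt hθ.2.1)
      have hsumΛ : ∀ y : P.Alg, borelSum P.𝒜 τ' (P.toSeries y) p = Λ y := fun y => by
        rw [hΛ, borelSum_eq h𝒜 hopen hρ (bounded_ext y).1 (norm_ext_le_exp y) hτ' hθ]
        rfl
      refine ⟨?_, ?_⟩
      · rw [mem_ball_zero_iff, hsumΛ, hΛ]
        exact (norm_lap_le x hθ.1 (hτ'.trans_lt hθ.2.1)).trans_lt hxB
      · have h := (hsum.map Λ Λ.continuous).tsum_eq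
        rw [map_zero] at h
        rw [sumSeries, ← h]
        refine tsum_congr fun k => ?_
        simp only [Function.comp_apply, map_mul, map_pow, hsumΛ, ← hf]
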